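/- Let $p$ be a prime, $n\ge 0$ an integer, $G=(\mathbb Z/p)^n$, and let $k$ be a field of characteristic $p$. Let $A=k[x_1,\dots,x_n]$ be the polynomial ring graded by $\deg(x_i)=-1$. A $p$-DG $A$-module is a $\mathbb Z$-graded $A$-module $M$ together with an $A$-linear map $d\colon M\to M$ of degree $-1$ such that $d^p=0$. It is called finitely generated if the underlying $A$-module is finitely generated, and free if the underlying graded $A$-module is a direct sum of shifts of $A$. For $1\le s\le p-1$ and $i\in\mathbb Z$ put $${}_sH_i(M)=\frac{\ker(d^s\colon M_i\to M_{i-s})}{\operatorname{im}(d^{p-s}\colon M_{i+p-s}\to M_i)},\qquad {}_sH_\bullet(M)=\bigoplus_{i\in\mathbb Z}{}_sH_i(M),$$ and define ${}_sH_i(M\otimes_A k)$ and ${}_sH_\bullet(M\otimes_A k)$ in the same way for the graded $k$-vector space $M\otimes_A k$ with the differential $d\otimes\mathrm{id}$, where $k=A/(x_1,\dots,x_n)$. Consider the finitely generated, free $p$-DG $A$-modules $M$ such that ${}_sH_\bullet(M\otimes_A k)\neq 0$ and $\dim_k {}_sH_\bullet(M)<\infty$ for all $1\le s\le p-1$. Then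 the minimum $$b_n=\min_M\ \sum_{i\in\mathbb Z}\dim_k {}_1H_i(M\otimes_A k)$$ over all such $M$ exists and is finite, and $$\sum_{i\in\mathbb Z}\dim_k H_i(C)\ \ge\ b_n$$ for every non-acyclic perfect chain complex $C$ over $k[G]$, where a perfect chain complex is a bounded complex of finitely generated projective $k[G]$-modules. -/

import Mathlib

open scoped TensorProduct DirectSum

universe u v

noncomputable section

/-- The dimension of a vector space, as an element of `{0, 1, 2, …, ∞}`. -/
def eDim (k : Type u) [Field k] (V : Type v) [AddCommGroup V] [Module k V] : ℕ∞ :=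
  Cardinal.toENat (Module.rank k V)

/-- An `N`-complex of `k`-vector spaces: a `ℤ`-graded vector space with an endomorphism `d` of
degree `-1` such that `d ^ N = 0`. -/
structure NComplex (N : ℕ) (k : Type u) [Field k] where
  carrier : Type v
  [addCommGroup : AddCommGroup carrier]
  [module : Module k carrier]
  grading : ℤ → Submodule k carrier
  isInternal : DirectSum.IsInternal grading
  d : carrier →ₗ[k] carrier
  d_mem : ∀ (i : ℤ) (x : carrier), x ∈ grading i → d x ∈ grading (i - 1)
  d_pow : d ^ N = 0

namespace NComplex

attribute [instance] NComplex.addCommGroup NComplex.module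

variable {N : ℕ} {k : Type u} [Field k] (C : NComplex.{u, v} N k)

/-- The kernel of `d ^ s : C_i → C_{i-s}`. -/
def cycles (s : ℕ) (i : ℤ) : Submodule k C.carrier :=
  C.grading i ⊓ LinearMap.ker (C.d ^ s)

/-- The image of `d ^ (N - s) : C_{i+N-s} → C_i`. -/
def boundaries (s : ℕ) (i : ℤ) : Submodule k C.carrier :=
  (C.grading (i + N - s)).map (C.d ^ (N - s))

/-- The homology `ₛH_i(C)`, meaningful for `1 ≤ s ≤ N - 1`. The boundaries are contained in the
cycles then, and are regarded as a subspace of the cycles. -/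
abbrev homology (s : ℕ) (i : ℤ) : Type v :=
  C.cycles s i ⧸ (C.boundaries s i).submoduleOf (C.cycles s i)

/-- The total homology `ₛH_•(C)`, the direct sum of the `ₛH_i(C)` over all integers `i`. -/
abbrev totalHomology (s : ℕ) : Type v :=
  ⨁ i : ℤ, C.homology s i

/-- The sum over all integers `i` of the dimensions of `ₛH_i(C)`. -/
def homologyDim (s : ℕ) : ℕ∞ :=
  ∑' i : ℤ, eDim k (C.homology s i)

end NComplex

/-- The grading of the polynomial ring `k[x_1, …, x_n]` in which every `x_i` has degree `-1`. -/
def polyGrading (n : ℕ) (k : Type u) [Field k] : ℤ → Submodule k (MvPolynomial (Fin n) k) :=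
  MvPolynomial.weightedHomogeneousSubmodule k (fun _ : Fin n => (-1 : ℤ))

/-- The ideal `(x_1, …, x_n)` of `k[x_1, …, x_n]`. -/
def augIdeal (n : ℕ) (k : Type u) [Field k] : Ideal (MvPolynomial (Fin n) k) :=
  Ideal.span (Set.range MvPolynomial.X)

/-- A `p`-differential graded module over `A = k[x_1, …, x_n]`, `deg x_i = -1`: a `ℤ`-graded
`A`-module with an `A`-linear endomorphism `d` of degree `-1` such that `d ^ p = 0`. The graded
pieces are `k`-subspaces; the `k`-action is the restriction of the `A`-action. -/
structure PDGModule (p n : ℕ) (k : Type u) [Field k] where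
  carrier : Type v
  [addCommGroup : AddCommGroup carrier]
  [moduleBase : Module k carrier]
  [module : Module (MvPolynomial (Fin n) k) carrier]
  [isScalarTower : IsScalarTower k (MvPolynomial (Fin n) k) carrier]
  grading : ℤ → Submodule k carrier
  isInternal : DirectSum.IsInternal grading
  smul_mem : ∀ (i j : ℤ) (a : MvPolynomial (Fin n) k) (m : carrier),
    a ∈ polyGrading n k i → m ∈ grading j → a • m ∈ grading (i + j)
  d : carrier →ₗ[MvPolynomial (Fin n) k] carrier
  d_mem : ∀ (i : ℤ) (m : carrier), m ∈ grading i → d m ∈ grading (i - 1)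
  d_pow : d ^ p = 0

namespace PDGModule

attribute [instance] PDGModule.addCommGroup PDGModule.moduleBase PDGModule.module
  PDGModule.isScalarTower

variable {p n : ℕ} {k : Type u} [Field k] (M : PDGModule.{u, v} p n k)

/-- The underlying graded `A`-module is free, that is, a direct sum of shifts of `A`: it has an
`A`-basis of homogeneous elements. -/
def IsFree : Prop :=
  ∃ (ι : Type v) (b : Module.Basis ι (MvPolynomial (Fin n) k) M.carrier) (c : ι → ℤ),
    ∀ j, b j ∈ M.grading (c j)

/-- The underlying `A`-module is finitely generated. -/
def IsFG : Prop := Module.Finite (MvPolynomial (Fin n) k) M.carrier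

/-- The underlying `p`-complex of `k`-vector spaces. -/
def toNComplex : NComplex.{u, v} p k where
  carrier := M.carrier
  grading := M.grading
  isInternal := M.isInternal
  d := M.d.restrictScalars k
  d_mem := M.d_mem
  d_pow := by
    ext m
    have h := LinearMap.congr_fun M.d_pow m
    rw [Module.End.pow_apply] at h ⊢
    exact h

/-- The underlying vector space of `M ⊗_A k`, with `k` identified with `A / (x_1, …, x_n)`. -/
abbrev Fiber : Type (max v u) :=
  M.carrier ⊗[MvPolynomial (Fin n) k] (MvPolynomial (Fin n) k ⧸ augIdeal n k)

/-- The `k`-linear map `M → M ⊗_A k`, `m ↦ m ⊗ 1`. -/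
def toFiber : M.carrier →ₗ[k] M.Fiber :=
  ((TensorProduct.mk (MvPolynomial (Fin n) k) M.carrier
    (MvPolynomial (Fin n) k ⧸ augIdeal n k)).flip 1).restrictScalars k

/-- The degree `i` part of `M ⊗_A k`, spanned by the `m ⊗ 1` with `m` of degree `i`. -/
def fiberGrading (i : ℤ) : Submodule k M.Fiber := (M.grading i).map M.toFiber

/-- The differential `d ⊗ id` of `M ⊗_A k`. -/
def fiberD : M.Fiber →ₗ[k] M.Fiber :=
  (M.d.rTensor (MvPolynomial (Fin n) k ⧸ augIdeal n k)).restrictScalars k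

theorem toFiber_surjective : Function.Surjective M.toFiber := by
  intro t
  induction t using TensorProduct.induction_on with
  | zero => exact ⟨0, map_zero _⟩
  | tmul m a =>
    obtain ⟨a, rfl⟩ := Ideal.Quotient.mk_surjective a
    refine ⟨a • m, ?_⟩
    change (a • m) ⊗ₜ (1 : MvPolynomial (Fin n) k ⧸ augIdeal n k) = _
    rw [TensorProduct.smul_tmul]
    congr 1
    exact mul_one (Ideal.Quotient.mk (augIdeal n k) a)
  | add x y hx hy =>
    obtain ⟨a, rfl⟩ := hx
    obtain ⟨b, rfl⟩ := hy
    exact ⟨a + b, map_add _ _ _⟩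

theorem toFiber_eq_zero_iff (m : M.carrier) :
    M.toFiber m = 0 ↔ m ∈ augIdeal n k • (⊤ : Submodule (MvPolynomial (Fin n) k) M.carrier) := by
  rw [← Submodule.Quotient.mk_eq_zero,
    ← (TensorProduct.tensorQuotEquivQuotSMul M.carrier (augIdeal n k)).symm.map_eq_zero_iff,
    TensorProduct.tensorQuotEquivQuotSMul_symm_mk]
  rfl

/-- The projection of `M` to its degree `i` part. -/
def proj (i : ℤ) : M.carrier →ₗ[k] M.carrier :=
  (M.grading i).subtype ∘ₗ DirectSum.component k ℤ (fun i => M.grading i) i ∘ₗ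
    (LinearEquiv.ofBijective (DirectSum.coeLinearMap M.grading) M.isInternal).symm.toLinearMap

theorem proj_of_mem {i j : ℤ} {m : M.carrier} (hm : m ∈ M.grading j) :
    M.proj i m = if j = i then m else 0 := by
  have h : (LinearEquiv.ofBijective (DirectSum.coeLinearMap M.grading) M.isInternal).symm m =
      DirectSum.lof k ℤ (fun i => M.grading i) j ⟨m, hm⟩ := by
    rw [LinearEquiv.symm_apply_eq]
    exact (DirectSum.coeLinearMap_lof M.grading j (⟨m, hm⟩ : M.grading j)).symm
  simp only [proj, LinearMap.comp_apply, LinearEquiv.coe_coe, h]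
  split_ifs with hij
  · subst hij
    rw [DirectSum.component.lof_self]
    rfl
  · rw [DirectSum.component.of, dif_neg hij]
    rfl

theorem proj_X_smul (i : ℤ) (j : Fin n) (m : M.carrier) :
    M.proj i ((MvPolynomial.X j : MvPolynomial (Fin n) k) • m) =
      (MvPolynomial.X j : MvPolynomial (Fin n) k) • M.proj (i + 1) m := by
  have hm : m ∈ ⨆ l, M.grading l := by
    rw [M.isInternal.submodule_iSup_eq_top]; trivial
  have hX : (MvPolynomial.X j : MvPolynomial (Fin n) k) ∈ polyGrading n k (-1) :=
    MvPolynomial.isWeightedHomogeneous_X k (fun _ : Fin n => (-1 : ℤ)) j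
  induction hm using Submodule.iSup_induction' with
  | mem l x hx =>
    rw [M.proj_of_mem hx, M.proj_of_mem (M.smul_mem _ _ _ _ hX hx)]
    by_cases h : l = i + 1
    · rw [if_pos h, if_pos (by omega)]
    · rw [if_neg h, if_neg (by omega), smul_zero]
  | zero => simp
  | add x y _ _ hx hy => rw [smul_add, map_add, map_add, smul_add, hx, hy]

theorem toFiber_proj_eq_zero {m : M.carrier} (hm : M.toFiber m = 0) (i : ℤ) :
    M.toFiber (M.proj i m) = 0 := by
  have key : ∀ r ∈ augIdeal n k, ∀ (m : M.carrier) (i : ℤ), M.proj i (r • m) ∈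
      augIdeal n k • (⊤ : Submodule (MvPolynomial (Fin n) k) M.carrier) := by
    intro r hr
    induction hr using Submodule.span_induction with
    | mem x hx =>
      obtain ⟨j, rfl⟩ := hx
      intro m i
      rw [proj_X_smul]
      exact Submodule.smul_mem_smul (Ideal.subset_span ⟨j, rfl⟩) trivial
    | zero => intro m i; simp
    | add x y _ _ hx hy =>
      intro m i
      rw [add_smul, map_add]
      exact add_mem (hx m i) (hy m i)
    | smul a x _ hx =>
      intro m i
      rw [smul_eq_mul, mul_comm, mul_smul]
      exact hx (a • m) i
  rw [toFiber_eq_zero_iff] at hm ⊢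
  induction hm using Submodule.smul_induction_on' with
  | smul r hr x _ => exact key r hr x i
  | add x _ y _ hx hy => rw [map_add]; exact add_mem hx hy

theorem fiberGrading_isInternal : DirectSum.IsInternal M.fiberGrading := by
  apply DirectSum.isInternal_submodule_of_iSupIndep_of_iSup_eq_top
  · intro i
    rw [Submodule.disjoint_def]
    rintro _ ⟨m, hm, rfl⟩ h
    simp only [fiberGrading, ← Submodule.map_iSup] at h
    obtain ⟨y, hy, hym⟩ := h
    have hle : (⨆ j, ⨆ (_ : j ≠ i), M.grading j) ≤ LinearMap.ker (M.proj i) := by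
      refine iSup₂_le fun j hj x hx => ?_
      rw [LinearMap.mem_ker, M.proj_of_mem hx, if_neg hj]
    have h0 : M.toFiber (m - y) = 0 := by rw [map_sub, hym, sub_self]
    have h1 := M.toFiber_proj_eq_zero h0 i
    rwa [map_sub, LinearMap.mem_ker.1 (hle hy), sub_zero, M.proj_of_mem hm, if_pos rfl] at h1
  · change ⨆ i, (M.grading i).map M.toFiber = ⊤
    rw [← Submodule.map_iSup, M.isInternal.submodule_iSup_eq_top, Submodule.map_top, LinearMap.range_eq_top]
    exact M.toFiber_surjective

/-- The `p`-complex `M ⊗_A k` of `k`-vector spaces. -/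
def fiber : NComplex.{u, max v u} p k where
  carrier := M.Fiber
  grading := M.fiberGrading
  isInternal := M.fiberGrading_isInternal
  d := M.fiberD
  d_mem := by
    rintro i _ ⟨m, hm, rfl⟩
    exact ⟨M.d m, M.d_mem i m hm, rfl⟩
  d_pow := by
    have h : ∀ (l : ℕ) (m : M.carrier), (M.fiberD ^ l) (M.toFiber m) = M.toFiber ((M.d ^ l) m) := by
      intro l
      induction l with
      | zero => intro m; rfl
      | succ l ih =>
        intro m
        rw [pow_succ, pow_succ, Module.End.mul_apply, Module.End.mul_apply, ← ih]
        rfl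
    ext t
    obtain ⟨m, rfl⟩ := M.toFiber_surjective t
    rw [h, M.d_pow]
    simp

end PDGModule

/-- The set of all values of `∑ i, dim ₁H_i(M ⊗_A k)`, where `M` ranges over the finitely
generated, free `p`-DG modules over `A = k[x_1, …, x_n]` such that `ₛH_•(M ⊗_A k)` is nonzero and
`ₛH_•(M)` is finite-dimensional for all `1 ≤ s ≤ p - 1`. -/
def fiberHomologyDims (p n : ℕ) (k : Type u) [Field k] : Set ℕ∞ :=
  {D | ∃ M : PDGModule.{u, u} p n k, M.IsFree ∧ M.IsFG ∧
    (∀ s : ℕ, 1 ≤ s → s ≤ p - 1 → Nontrivial (M.fiber.totalHomology s)) ∧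
    (∀ s : ℕ, 1 ≤ s → s ≤ p - 1 → Module.Finite k (M.toNComplex.totalHomology s)) ∧
    D = M.fiber.homologyDim 1}

/-- The group ring `k[G]` of `G = (ℤ/p)^n`. -/
abbrev ElemAbGroupRing (p n : ℕ) (k : Type u) [Field k] : Type u :=
  MonoidAlgebra k (Multiplicative (Fin n → ZMod p))

/-- A perfect chain complex: a bounded complex of finitely generated projective modules. -/
def IsPerfectComplex {R : Type u} [Ring R] (C : ChainComplex (ModuleCat.{v} R) ℤ) : Prop :=
  (∃ a b : ℤ, ∀ i : ℤ, i < a ∨ b < i → CategoryTheory.Limits.IsZero (C.X i)) ∧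
    ∀ i : ℤ, Module.Finite R (C.X i) ∧ Module.Projective R (C.X i)

/-- The sum over all integers `i` of the `k`-dimensions of the homology modules `H_i(C)` of a chain
complex `C` of modules over a `k`-algebra `R`. -/
def chainHomologyDim (k : Type u) [Field k] {R : Type u} [Ring R] [Algebra k R]
    (C : ChainComplex (ModuleCat.{v} R) ℤ) : ℕ∞ :=
  ∑' i : ℤ, eDim k ((ModuleCat.restrictScalars (algebraMap k R)).obj (C.homology i))

end

/-!
Write `k[G] = k[y₁, …, yₙ] / (y₁ᵖ, …, yₙᵖ)`. Repeating the terms of odd degree of a perfect complex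
`C` over `k[G]` `p - 1` times gives a `p`-complex `V` whose homology `₁H_•(V)` has the same total
dimension as `H_•(C)`. As `p = 0` in `k`, the map `d + ∑ xᵢ yᵢ` on `A ⊗ V` is a `p`-differential,
and the resulting free `p`-DG module `M` has fiber `V`. So the total dimension of `H_•(C)` is one of
the values over which `bₙ` is the minimum, provided that `ₛH_•(M)` is finite-dimensional.

For this it suffices that a power of each `xᵢ` annihilates `ₛH_•(M)`. Since the terms of `C` are
projective, they carry connections along the derivation `δᵢ` of `k[G]` with `δᵢ yⱼ = δᵢⱼ`. Let `D`
be the differential of `M` and `θ` the negative of such a connection, so that `[D, θ]` is `xᵢ` plus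
terms which lower a bounded filtration. As `ad D` is a derivation with `(ad D)ᵖ = 0`, the operator
`w = (ad D)^(p-1) (θ^(p-1))` commutes with `D`, it maps `ker Dˢ` into `im D^(p-s)`, and by Wilson's
theorem it differs from `(p-1)! xᵢ^(p-1) = -xᵢ^(p-1)` by a nilpotent operator.
-/

section CharacteristicP

variable {R : Type*} [Ring R] {p : ℕ} [Fact p.Prime]

theorem add_pow_prime_eq_zero (hp : (p : R) = 0) {x y : R} (hxy : Commute x y)
    (hx : x ^ p = 0) (hy : y ^ p = 0) : (x + y) ^ p = 0 := by
  obtain ⟨r, hr⟩ := hxy.exists_add_pow_prime_eq (Fact.out : p.Prime)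
  rw [hr, hx, hy, hp, zero_mul, zero_mul, zero_mul, add_zero, add_zero]

theorem sum_pow_prime_eq_zero (hp : (p : R) = 0) {ι : Type*} (s : Finset ι) {f : ι → R}
    (hcomm : ∀ i j, Commute (f i) (f j)) (hf : ∀ i, f i ^ p = 0) : (∑ i ∈ s, f i) ^ p = 0 := by
  classical
  induction s using Finset.induction_on with
  | empty => rw [Finset.sum_empty, zero_pow (Fact.out : p.Prime).ne_zero]
  | insert i s hi ih =>
    rw [Finset.sum_insert hi]
    exact add_pow_prime_eq_zero hp (Commute.sum_right s f (f i) fun j _ => hcomm i j) (hf i) ih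

theorem natCast_factorial_pred_prime (hp : (p : R) = 0) : ((p - 1).factorial : R) = -1 := by
  have wilson : (p : ℤ) ∣ (p - 1).factorial + 1 := by
    rw [← ZMod.intCast_zmod_eq_zero_iff_dvd]
    push_cast
    rw [ZMod.wilsons_lemma, neg_add_cancel]
  obtain ⟨c, hc⟩ := wilson
  have hcast := congrArg (Int.cast : ℤ → R) hc
  push_cast at hcast
  rwa [hp, zero_mul, add_eq_zero_iff_eq_neg] at hcast

end CharacteristicP

section AdjointPowers

open LieAlgebra

attribute [local instance] LieRing.ofAssociativeRing

variable {A : Type*} [CommRing A] {p : ℕ}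

theorem ad_eq_mulLeft_add_mulRight_neg {R : Type*} [Ring R] [Algebra A R] (D : R) :
    ad A R D = LinearMap.mulLeft A D + LinearMap.mulRight A (-D) := by
  ext h
  rw [ad_apply, Ring.lie_def, LinearMap.add_apply, LinearMap.mulLeft_apply,
    LinearMap.mulRight_apply, mul_neg, sub_eq_add_neg]

theorem ad_pow_prime_eq_zero {R : Type*} [Ring R] [Algebra A R] [Fact p.Prime] (hp : (p : A) = 0)
    {D : R} (hD : D ^ p = 0) : ad A R D ^ p = 0 := by
  have hpEnd : (p : Module.End A R) = 0 := by
    rw [← map_natCast (algebraMap A (Module.End A R)), hp, map_zero]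
  rw [ad_eq_mulLeft_add_mulRight_neg]
  refine add_pow_prime_eq_zero hpEnd (LinearMap.commute_mulLeft_right D (-D)) ?_ ?_
  · rw [LinearMap.pow_mulLeft, hD, LinearMap.mulLeft_zero_eq_zero]
  · rw [LinearMap.pow_mulRight, neg_pow, hD, mul_zero, LinearMap.mulRight_zero_eq_zero]

variable {E : Type*} [AddCommGroup E] [Module A E]

theorem ad_pow_apply_mem_range (D h : Module.End A E) {s : ℕ} (hs : s ≤ p) {z : E}
    (hz : (D ^ s) z = 0) :
    (ad A (Module.End A E) D ^ (p - 1)) h z ∈ LinearMap.range (D ^ (p - s)) := by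
  have expansion : (ad A (Module.End A E) D ^ (p - 1)) h z =
      ∑ i ∈ Finset.range (p - 1 + 1),
        (p - 1).choose i • (D ^ i) (h (((-D) ^ (p - 1 - i)) z)) := by
    rw [ad_eq_mulLeft_add_mulRight_neg, (LinearMap.commute_mulLeft_right D (-D)).add_pow']
    simp only [Finset.Nat.sum_antidiagonal_eq_sum_range_succ_mk, LinearMap.pow_mulLeft,
      LinearMap.pow_mulRight, LinearMap.sum_apply, LinearMap.smul_apply, Module.End.mul_apply,
      LinearMap.mulLeft_apply, LinearMap.mulRight_apply]
  rw [expansion]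
  refine sum_mem fun i _ => nsmul_mem ?_ _
  obtain hi | hi := le_or_gt s (p - 1 - i)
  · rw [neg_pow, Module.End.mul_apply, Module.End.pow_map_zero_of_le hi hz, map_zero, map_zero,
      map_zero]
    exact zero_mem _
  · have hrange : LinearMap.range (D ^ i) ≤ LinearMap.range (D ^ (p - s)) :=
      (LinearMap.iterateRange D).monotone (by omega)
    exact hrange (LinearMap.mem_range_self _ _)

end AdjointPowers

section Annihilation

open LieAlgebra

attribute [local instance] LieRing.ofAssociativeRing

variable {A E : Type*} [CommRing A] [AddCommGroup E] [Module A E]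

/-- The endomorphisms lowering the filtration index by at least `c`. -/
def loweringEnd (F : ℤ → Submodule A E) (c : ℤ) : Submodule A (Module.End A E) where
  carrier := {f | ∀ j, ∀ x ∈ F j, f x ∈ F (j - c)}
  add_mem' hf hg j x hx := add_mem (hf j x hx) (hg j x hx)
  zero_mem' j _ _ := zero_mem (F (j - c))
  smul_mem' a _ hf j x hx := Submodule.smul_mem _ a (hf j x hx)

variable {F : ℤ → Submodule A E}

theorem mem_loweringEnd {c : ℤ} {f : Module.End A E} :
    f ∈ loweringEnd F c ↔ ∀ j, ∀ x ∈ F j, f x ∈ F (j - c) :=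
  Iff.rfl

instance : SetLike.GradedMonoid (loweringEnd F) where
  one_mem := mem_loweringEnd.2 fun j x hx => by simpa using hx
  mul_mem c c' f g hf hg := mem_loweringEnd.2 fun j x hx => by
    have h := mem_loweringEnd.1 hf _ _ (mem_loweringEnd.1 hg _ _ hx)
    rwa [sub_sub, add_comm] at h

theorem isNilpotent_of_mem_loweringEnd_one (hF : Monotone F) {a b : ℤ} (ha : F a = ⊥)
    (hb : F b = ⊤) {ν : Module.End A E} (hν : ν ∈ loweringEnd F 1) : IsNilpotent ν := by
  refine ⟨(b - a).toNat, LinearMap.ext fun x => ?_⟩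
  have hx : (ν ^ (b - a).toNat) x ∈ F (b - (b - a).toNat • 1) :=
    mem_loweringEnd.1 (SetLike.pow_mem_graded _ hν) b x (hb ▸ Submodule.mem_top)
  have hle : b - (b - a).toNat • 1 ≤ a := by
    rw [nsmul_one]
    omega
  simpa [ha] using hF hle hx

theorem mul_mem_loweringEnd_one_of_left {f g : Module.End A E} (hf : f ∈ loweringEnd F 0)
    (hg : g ∈ loweringEnd F 1) : f * g ∈ loweringEnd F 1 := by
  simpa using SetLike.mul_mem_graded hf hg

theorem mul_mem_loweringEnd_one_of_right {f g : Module.End A E} (hf : f ∈ loweringEnd F 1)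
    (hg : g ∈ loweringEnd F 0) : f * g ∈ loweringEnd F 1 := by
  simpa using SetLike.mul_mem_graded hf hg

theorem ad_mem_loweringEnd_one {D f : Module.End A E} (hD : D ∈ loweringEnd F 0)
    (hf : f ∈ loweringEnd F 1) : ad A (Module.End A E) D f ∈ loweringEnd F 1 :=
  sub_mem (mul_mem_loweringEnd_one_of_left hD hf) (mul_mem_loweringEnd_one_of_right hf hD)

theorem lie_pow_succ_sub_mem_loweringEnd_one {D θ : Module.End A E} (hθ : θ ∈ loweringEnd F 0)
    {x : A} (hx : ⁅D, θ⁆ - algebraMap A (Module.End A E) x ∈ loweringEnd F 1) (m : ℕ) :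
    ⁅D, θ ^ (m + 1)⁆ - ((m + 1) * x) • θ ^ m ∈ loweringEnd F 1 := by
  induction m with
  | zero => simpa [Algebra.algebraMap_eq_smul_one] using hx
  | succ m ih =>
    have hθm : θ ^ (m + 1) ∈ loweringEnd F 0 := by
      simpa using SetLike.pow_mem_graded (m + 1) hθ
    convert add_mem (mul_mem_loweringEnd_one_of_right hx hθm)
      (mul_mem_loweringEnd_one_of_left hθ ih) using 1
    rw [Algebra.algebraMap_eq_smul_one, sub_mul, mul_sub, smul_mul_assoc, one_mul, mul_smul_comm,
      ← pow_succ', Ring.lie_def, Ring.lie_def, Ring.lie_def, Nat.cast_succ, pow_succ' θ (m + 1),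
      sub_mul, mul_sub, mul_assoc, mul_assoc, mul_assoc]
    module

theorem ad_pow_pow_sub_mem_loweringEnd_one {D θ : Module.End A E} (hD : D ∈ loweringEnd F 0)
    (hθ : θ ∈ loweringEnd F 0) {x : A}
    (hx : ⁅D, θ⁆ - algebraMap A (Module.End A E) x ∈ loweringEnd F 1) (m : ℕ) :
    (ad A (Module.End A E) D ^ m) (θ ^ m) -
      algebraMap A (Module.End A E) (m.factorial * x ^ m) ∈ loweringEnd F 1 := by
  have had (m : ℕ) {f : Module.End A E} (hf : f ∈ loweringEnd F 1) :
      (ad A (Module.End A E) D ^ m) f ∈ loweringEnd F 1 := by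
    induction m with
    | zero => exact hf
    | succ m ih =>
      rw [pow_succ', Module.End.mul_apply]
      exact ad_mem_loweringEnd_one hD ih
  induction m with
  | zero => simp
  | succ m ih =>
    convert add_mem (had m (lie_pow_succ_sub_mem_loweringEnd_one hθ hx m))
      (Submodule.smul_mem _ ((m + 1) * x) ih) using 1
    rw [pow_succ (ad A (Module.End A E) D), Module.End.mul_apply, ad_apply, map_sub, map_smul,
      smul_sub, Algebra.algebraMap_eq_smul_one, Algebra.algebraMap_eq_smul_one, smul_smul,
      Nat.factorial_succ, sub_add_sub_cancel]
    congr 2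
    push_cast
    ring

theorem exists_algebraMap_pow_eq_mul {R : Type*} [Ring R] [Algebra A R] {D w : R}
    (hw : Commute D w) {a : A} (h : IsNilpotent (algebraMap A R a - w)) :
    ∃ N : ℕ, ∃ G : R, Commute D G ∧ algebraMap A R (a ^ N) = w * G := by
  obtain ⟨N, hN⟩ := h
  refine ⟨N, ∑ i ∈ Finset.range N,
    algebraMap A R a ^ i * (algebraMap A R a - w) ^ (N - 1 - i), ?_, ?_⟩
  · have ha : Commute D (algebraMap A R a) := Algebra.commute_algebraMap_right a D
    exact Commute.sum_right _ _ _ fun i _ =>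
      (ha.pow_right i).mul_right ((ha.sub_right hw).pow_right _)
  · have hfactor := (Algebra.commute_algebraMap_left a (algebraMap A R a - w)).mul_geom_sum₂ N
    rw [sub_sub_cancel, hN, sub_zero] at hfactor
    rw [map_pow, hfactor]

theorem exists_pow_smul_mem_range {p : ℕ} [Fact p.Prime] (hp : (p : A) = 0) (hF : Monotone F)
    {a b : ℤ} (ha : F a = ⊥) (hb : F b = ⊤) {D θ : Module.End A E} (hDp : D ^ p = 0)
    (hD : D ∈ loweringEnd F 0) (hθ : θ ∈ loweringEnd F 0) {x : A}
    (hx : ⁅D, θ⁆ - algebraMap A (Module.End A E) x ∈ loweringEnd F 1) :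
    ∃ N : ℕ, ∀ s ≤ p, ∀ z, (D ^ s) z = 0 → x ^ N • z ∈ LinearMap.range (D ^ (p - s)) := by
  set w := (ad A (Module.End A E) D ^ (p - 1)) (θ ^ (p - 1)) with hw
  have hDw : Commute D w := by
    rw [commute_iff_lie_eq, ← ad_apply A, hw, ← Module.End.mul_apply, ← pow_succ',
      Nat.sub_add_cancel (Fact.out : p.Prime).one_le, ad_pow_prime_eq_zero hp hDp,
      LinearMap.zero_apply]
  have hnil : IsNilpotent (algebraMap A (Module.End A E) (x ^ (p - 1)) - -w) := by
    refine isNilpotent_of_mem_loweringEnd_one hF ha hb ?_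
    convert ad_pow_pow_sub_mem_loweringEnd_one hD hθ hx (p - 1) using 1
    rw [natCast_factorial_pred_prime hp, neg_one_mul, map_neg, ← hw]
    abel
  obtain ⟨N, G, hDG, hfactor⟩ := exists_algebraMap_pow_eq_mul hDw.neg_right hnil
  refine ⟨(p - 1) * N, fun s hs z hz => ?_⟩
  have hGz : (D ^ s) (G z) = 0 := by
    rw [← Module.End.mul_apply, (hDG.pow_left s).eq, Module.End.mul_apply, hz, map_zero]
  rw [pow_mul, ← Module.algebraMap_end_apply A A, hfactor, Module.End.mul_apply,
    LinearMap.neg_apply]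
  exact neg_mem (ad_pow_apply_mem_range D _ hs hGz)

end Annihilation

theorem restrictScalars_pow_apply (k : Type*) {A E : Type*} [Semiring k] [Semiring A]
    [AddCommMonoid E] [Module k E] [Module A E] [LinearMap.CompatibleSMul E E k A]
    (f : Module.End A E) (l : ℕ) (z : E) :
    ((f.restrictScalars k : Module.End k E) ^ l) z = (f ^ l) z :=
  (Module.End.pow_apply _ l z).trans (Module.End.pow_apply f l z).symm

section FiniteDimensionality

open MvPolynomial

variable {k σ : Type*} [CommRing k]

theorem isIntegral_quotient_of_X_pow_mem {I : Ideal (MvPolynomial σ k)}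
    (h : ∀ i, ∃ N : ℕ, X i ^ N ∈ I) : Algebra.IsIntegral k (MvPolynomial σ k ⧸ I) := by
  refine ⟨fun x => ?_⟩
  obtain ⟨f, rfl⟩ := Ideal.Quotient.mk_surjective x
  induction f using MvPolynomial.induction_on with
  | C a => exact isIntegral_algebraMap (R := k) (A := MvPolynomial σ k ⧸ I) (x := a)
  | add f g hf hg => exact map_add (Ideal.Quotient.mk I) f g ▸ hf.add hg
  | mul_X f i hf =>
    obtain ⟨N, hN⟩ := h i
    refine map_mul (Ideal.Quotient.mk I) f (X i) ▸ hf.mul (.of_pow N.succ_pos ?_)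
    rw [← map_pow, Ideal.Quotient.eq_zero_iff_mem.2 (I.pow_mem_of_pow_mem hN N.le_succ)]
    exact isIntegral_zero

theorem finite_of_forall_exists_X_pow_smul_eq_zero [Finite σ] {Q : Type*} [AddCommGroup Q]
    [Module k Q] [Module (MvPolynomial σ k) Q] [IsScalarTower k (MvPolynomial σ k) Q]
    [Module.Finite (MvPolynomial σ k) Q]
    (h : ∀ i, ∃ N : ℕ, ∀ q : Q, (X i : MvPolynomial σ k) ^ N • q = 0) : Module.Finite k Q := by
  set I := Module.annihilator (MvPolynomial σ k) Q
  let _ : Module (MvPolynomial σ k ⧸ I) Q := Module.quotientAnnihilator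
  have : IsScalarTower (MvPolynomial σ k) (MvPolynomial σ k ⧸ I) Q :=
    .of_algebraMap_smul fun _ _ => rfl
  have : IsScalarTower k (MvPolynomial σ k ⧸ I) Q :=
    .to₁₃₄ k (MvPolynomial σ k) (MvPolynomial σ k ⧸ I) Q
  have : Algebra.IsIntegral k (MvPolynomial σ k ⧸ I) := isIntegral_quotient_of_X_pow_mem fun i =>
    (h i).imp fun _ hN => Module.mem_annihilator.2 hN
  have : Module.Finite k (MvPolynomial σ k ⧸ I) := Algebra.IsIntegral.finite
  have : Module.Finite (MvPolynomial σ k ⧸ I) Q :=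
    Module.Finite.of_restrictScalars_finite (MvPolynomial σ k) _ _
  exact Module.Finite.trans (MvPolynomial σ k ⧸ I) Q

end FiniteDimensionality

namespace NComplex

variable {N : ℕ} {k : Type u} [Field k]

section UngradedHomology

variable (C : NComplex.{u, v} N k) (s : ℕ)

theorem d_pow_mem (l : ℕ) {i : ℤ} {x : C.carrier} (hx : x ∈ C.grading i) :
    (C.d ^ l) x ∈ C.grading (i - l) := by
  induction l with
  | zero => simpa using hx
  | succ l ih =>
    rw [pow_succ', Module.End.mul_apply, Nat.cast_succ, ← sub_sub]
    exact C.d_mem _ _ ih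

theorem totalHomology_nontrivial {i : ℤ} (h : ¬ C.cycles s i ≤ C.boundaries s i) :
    Nontrivial (C.totalHomology s) := by
  classical
  have : Nontrivial (C.homology s i) := by
    rwa [Submodule.Quotient.nontrivial_iff, ne_eq, Submodule.submoduleOf_eq_top]
  exact (DirectSum.of_injective (β := C.homology s) i).nontrivial

/-- The projection to the degree `i` part. -/
noncomputable def proj (i : ℤ) : C.carrier →ₗ[k] C.carrier :=
  (C.grading i).subtype ∘ₗ DirectSum.component k ℤ (fun i => C.grading i) i ∘ₗ
    (LinearEquiv.ofBijective (DirectSum.coeLinearMap C.grading) C.isInternal).symm.toLinearMap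

theorem proj_mem (i : ℤ) (x : C.carrier) : C.proj i x ∈ C.grading i :=
  Subtype.property _

theorem proj_of_mem {i : ℤ} {x : C.carrier} (hx : x ∈ C.grading i) : C.proj i x = x :=
  congrArg Subtype.val (C.isInternal.ofBijective_coeLinearMap_of_mem hx)

theorem proj_of_mem_ne {i j : ℤ} (hij : i ≠ j) {x : C.carrier} (hx : x ∈ C.grading i) :
    C.proj j x = 0 :=
  congrArg Subtype.val (C.isInternal.ofBijective_coeLinearMap_of_mem_ne hij hx)

theorem proj_d_pow (l : ℕ) (i : ℤ) (x : C.carrier) :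
    C.proj i ((C.d ^ l) x) = (C.d ^ l) (C.proj (i + l) x) := by
  have hx : x ∈ ⨆ j, C.grading j := C.isInternal.submodule_iSup_eq_top ▸ Submodule.mem_top
  induction hx using Submodule.iSup_induction' with
  | zero => simp only [map_zero]
  | add x y _ _ hx hy => simp only [map_add, hx, hy]
  | mem j x hx =>
    obtain rfl | hj := eq_or_ne j (i + l)
    · have hdx := C.d_pow_mem l hx
      rw [add_sub_cancel_right] at hdx
      rw [C.proj_of_mem hx, C.proj_of_mem hdx]
    · rw [C.proj_of_mem_ne hj hx, C.proj_of_mem_ne (by omega) (C.d_pow_mem l hx), map_zero]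

/-- The homology `ker d ^ s / im d ^ (N - s)` with the grading forgotten, which has the same
dimension as `C.totalHomology s`. -/
abbrev ungradedHomology : Type v :=
  LinearMap.ker (C.d ^ s) ⧸ (LinearMap.range (C.d ^ (N - s))).submoduleOf (LinearMap.ker (C.d ^ s))

/-- The map induced on homology by the inclusions of the graded pieces. -/
noncomputable def toUngradedHomology : C.totalHomology s →ₗ[k] C.ungradedHomology s :=
  DirectSum.toModule k ℤ _ fun i =>
    Submodule.mapQ _ _ (Submodule.inclusion (inf_le_right : C.cycles s i ≤ LinearMap.ker (C.d ^ s)))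
      fun _ ⟨y, _, hy⟩ => ⟨y, hy⟩

variable {s}

theorem proj_mem_cycles (i : ℤ) {x : C.carrier} (hx : x ∈ LinearMap.ker (C.d ^ s)) :
    C.proj i x ∈ C.cycles s i := by
  refine ⟨C.proj_mem i x, ?_⟩
  have h := C.proj_d_pow s (i - s) x
  rwa [LinearMap.mem_ker.1 hx, map_zero, sub_add_cancel, eq_comm] at h

theorem proj_mem_boundaries (hs : s ≤ N) (i : ℤ) {x : C.carrier}
    (hx : x ∈ LinearMap.range (C.d ^ (N - s))) : C.proj i x ∈ C.boundaries s i := by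
  obtain ⟨y, rfl⟩ := hx
  rw [proj_d_pow, Nat.cast_sub hs, ← add_sub_assoc]
  exact Submodule.mem_map_of_mem (C.proj_mem _ y)

theorem toUngradedHomology_injective (hs : s ≤ N) :
    Function.Injective (C.toUngradedHomology s) := by
  classical
  let toHomology (i : ℤ) : C.ungradedHomology s →ₗ[k] C.homology s i :=
    Submodule.mapQ _ _ ((C.proj i).restrict fun _ hx => C.proj_mem_cycles i hx)
      fun _ hx => C.proj_mem_boundaries hs i hx
  have hcomp (i : ℤ) : toHomology i ∘ₗ C.toUngradedHomology s = DirectSum.component k ℤ _ i := by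
    refine DirectSum.linearMap_ext k fun j => Submodule.linearMap_qext _ (LinearMap.ext fun z => ?_)
    simp only [LinearMap.comp_apply, toUngradedHomology, DirectSum.toModule_lof]
    obtain rfl | hj := eq_or_ne j i
    · rw [DirectSum.component.lof_self]
      exact congrArg (Submodule.mkQ _) (Subtype.ext (C.proj_of_mem z.2.1))
    · rw [DirectSum.component.of, dif_neg hj]
      exact (congrArg (Submodule.mkQ _) (Subtype.ext (C.proj_of_mem_ne hj z.2.1))).trans
        (map_zero _)
  refine (injective_iff_map_eq_zero _).2 fun x hx => DFinsupp.ext fun i => ?_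
  have h := LinearMap.congr_fun (hcomp i) x
  rwa [LinearMap.comp_apply, hx, map_zero, eq_comm] at h

theorem totalHomology_finite (hs : s ≤ N) [Module.Finite k (C.ungradedHomology s)] :
    Module.Finite k (C.totalHomology s) :=
  Module.Finite.of_injective _ (C.toUngradedHomology_injective hs)

end UngradedHomology

/-- An isomorphism of `N`-complexes: a linear equivalence compatible with the differentials and
the gradings. -/
structure Equiv (C C' : NComplex.{u, v} N k) extends C.carrier ≃ₗ[k] C'.carrier where
  map_d : ∀ x, toFun (C.d x) = C'.d (toFun x)
  mem_grading_iff : ∀ i x, toFun x ∈ C'.grading i ↔ x ∈ C.grading i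

namespace Equiv

variable {C C' : NComplex.{u, v} N k}

theorem map_d_pow (e : Equiv C C') (l : ℕ) (x : C.carrier) :
    e.toLinearEquiv ((C.d ^ l) x) = (C'.d ^ l) (e.toLinearEquiv x) := by
  induction l with
  | zero => rfl
  | succ l ih =>
    rw [pow_succ', pow_succ', Module.End.mul_apply, Module.End.mul_apply, ← ih]
    exact e.map_d _

theorem mem_cycles_iff (e : Equiv C C') (s : ℕ) (i : ℤ) (x : C.carrier) :
    e.toLinearEquiv x ∈ C'.cycles s i ↔ x ∈ C.cycles s i := by
  refine and_congr (e.mem_grading_iff i x) ?_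
  rw [SetLike.mem_coe, SetLike.mem_coe, LinearMap.mem_ker, LinearMap.mem_ker, ← map_d_pow,
    e.toLinearEquiv.map_eq_zero_iff]

theorem mem_boundaries_iff (e : Equiv C C') (s : ℕ) (i : ℤ) (x : C.carrier) :
    e.toLinearEquiv x ∈ C'.boundaries s i ↔ x ∈ C.boundaries s i := by
  constructor
  · rintro ⟨y, hy, hyx⟩
    obtain ⟨y, rfl⟩ := e.toLinearEquiv.surjective y
    exact ⟨y, (e.mem_grading_iff _ y).1 hy, e.toLinearEquiv.injective ((e.map_d_pow _ y).trans hyx)⟩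
  · rintro ⟨y, hy, rfl⟩
    exact ⟨e.toLinearEquiv y, (e.mem_grading_iff _ y).2 hy, (e.map_d_pow _ y).symm⟩

theorem cycles_le_boundaries_iff (e : Equiv C C') (s : ℕ) (i : ℤ) :
    C'.cycles s i ≤ C'.boundaries s i ↔ C.cycles s i ≤ C.boundaries s i := by
  simp only [SetLike.le_def, e.toLinearEquiv.surjective.forall, mem_cycles_iff, mem_boundaries_iff]

theorem homologyDim_eq (e : Equiv C C') (s : ℕ) : C.homologyDim s = C'.homologyDim s := by
  refine tsum_congr fun i => congrArg Cardinal.toENat (LinearEquiv.rank_eq ?_)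
  have hcycles : (C.cycles s i).map e.toLinearEquiv.toLinearMap = C'.cycles s i := by
    ext z
    obtain ⟨x, rfl⟩ := e.toLinearEquiv.surjective z
    rw [e.mem_cycles_iff]
    exact e.toLinearEquiv.injective.mem_set_image
  refine Submodule.Quotient.equiv _ _ (e.toLinearEquiv.ofSubmodules _ _ hcycles) ?_
  ext z
  obtain ⟨x, rfl⟩ := (e.toLinearEquiv.ofSubmodules _ _ hcycles).surjective z
  exact (Submodule.mem_map_equiv _).trans <| by
    rw [LinearEquiv.symm_apply_apply]
    exact (e.mem_boundaries_iff s i x).symm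

end Equiv

end NComplex

namespace PDGModule

variable {p n : ℕ} {k : Type u} [Field k] (M : PDGModule.{u, v} p n k)

theorem totalHomology_finite (hM : M.IsFG) {s : ℕ} (hs : s ≤ p)
    (h : ∀ i : Fin n, ∃ N : ℕ, ∀ z : M.carrier, (M.d ^ s) z = 0 →
      (MvPolynomial.X i : MvPolynomial (Fin n) k) ^ N • z ∈ LinearMap.range (M.d ^ (p - s))) :
    Module.Finite k (M.toNComplex.totalHomology s) := by
  have : Module.Finite (MvPolynomial (Fin n) k) M.carrier := hM
  let Z := LinearMap.ker (M.d ^ s)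
  let B := (LinearMap.range (M.d ^ (p - s))).submoduleOf Z
  have : Module.Finite k (Z ⧸ B) := by
    refine finite_of_forall_exists_X_pow_smul_eq_zero (σ := Fin n) fun i => ?_
    obtain ⟨N, hN⟩ := h i
    refine ⟨N, fun q => ?_⟩
    obtain ⟨z, rfl⟩ := B.mkQ_surjective q
    rw [← map_smul, Submodule.mkQ_apply, Submodule.Quotient.mk_eq_zero]
    exact hN z z.2
  have : Module.Finite k (M.toNComplex.ungradedHomology s) := by
    have hker : LinearMap.ker (M.toNComplex.d ^ s) = Z.restrictScalars k :=
      Submodule.ext fun z => Eq.congr_left (restrictScalars_pow_apply k M.d s z)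
    have hrange : LinearMap.range (M.toNComplex.d ^ (p - s)) =
        (LinearMap.range (M.d ^ (p - s))).restrictScalars k :=
      Submodule.ext fun z => exists_congr fun y =>
        Eq.congr_left (restrictScalars_pow_apply k M.d _ y)
    dsimp only [NComplex.ungradedHomology]
    rw [hker, hrange]
    exact Module.Finite.equiv (Submodule.Quotient.restrictScalarsEquiv k B).symm
  exact M.toNComplex.totalHomology_finite hs

end PDGModule

theorem iSupIndep_of_repr_apply_eq_zero {ι κ K W : Type*} [Semiring K] [AddCommMonoid W]
    [Module K W] (b : Module.Basis ι K W) (deg : ι → κ) {F : κ → Submodule K W}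
    (h : ∀ i, ∀ x ∈ F i, ∀ j, deg j ≠ i → b.repr x j = 0) : iSupIndep F := by
  intro i
  rw [Submodule.disjoint_def]
  intro x hx hx'
  refine b.ext_elem fun j => ?_
  rw [map_zero, Finsupp.zero_apply]
  by_cases hj : deg j = i
  · have hker : ⨆ l, ⨆ (_ : l ≠ i), F l ≤ LinearMap.ker (b.coord j) :=
      iSup₂_le fun l hl y hy => h l y hy j fun hjl => hl (hjl.symm.trans hj)
    exact hker hx'
  · exact h i x hx j hj

section BaseChange

variable {k A W : Type*} [CommRing k] [CommRing A] [Algebra k A] [AddCommGroup W] [Module k W]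

theorem mem_loweringEnd_iSup_le {G : ℤ → Submodule k W} {f : Module.End k W} {c : ℤ}
    (hf : ∀ i, ∀ x ∈ G i, f x ∈ G (i - c)) : f ∈ loweringEnd (fun j => ⨆ i ≤ j, G i) c := by
  refine mem_loweringEnd.2 fun j => ?_
  change ⨆ i ≤ j, G i ≤ (⨆ i ≤ j - c, G i).comap f
  exact iSup₂_le fun i hi x hx => le_iSup₂ (f := fun i (_ : i ≤ j - c) => G i) (i - c)
    (by omega) (hf i x hx)

variable (A) in
theorem baseChange_mem_loweringEnd {F : ℤ → Submodule k W} {f : Module.End k W} {c : ℤ}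
    (hf : f ∈ loweringEnd F c) :
    f.baseChange A ∈ loweringEnd (fun j => (F j).baseChange A) c := by
  refine mem_loweringEnd.2 fun j => ?_
  change (F j).baseChange A ≤ ((F (j - c)).baseChange A).comap (f.baseChange A)
  rw [Submodule.baseChange_eq_span, Submodule.span_le]
  rintro _ ⟨w, hw, rfl⟩
  exact Submodule.tmul_mem_baseChange_of_mem 1 (mem_loweringEnd.1 hf j w hw)

theorem lie_baseChange (f g : Module.End k W) :
    ⁅f.baseChange A, g.baseChange A⁆ = ⁅f, g⁆.baseChange A := by
  rw [Ring.lie_def, Ring.lie_def, LinearMap.baseChange_sub, LinearMap.baseChange_mul,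
    LinearMap.baseChange_mul]

theorem lie_add_sum_smul {R ι : Type*} [Ring R] [Algebra A R] (s : Finset ι) (x : ι → A)
    (y : ι → R) (d f : R) : ⁅d + ∑ i ∈ s, x i • y i, f⁆ = ⁅d, f⁆ + ∑ i ∈ s, x i • ⁅y i, f⁆ := by
  simp only [Ring.lie_def, add_mul, mul_add, Finset.sum_mul, Finset.mul_sum, smul_mul_assoc,
    mul_smul_comm, smul_sub, Finset.sum_sub_distrib]
  abel

end BaseChange

open MvPolynomial in
theorem mem_augIdeal_iff {n : ℕ} {k : Type u} [Field k] {f : MvPolynomial (Fin n) k} :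
    f ∈ augIdeal n k ↔ constantCoeff f = 0 := by
  rw [← pow_one (augIdeal n k)]
  refine (mem_pow_idealOfVars_iff' (σ := Fin n) 1 f).trans ?_
  simp [Finsupp.degree_eq_zero_iff, constantCoeff_eq]

/-- A `p`-complex of vector spaces with commuting `p`-nilpotent endomorphisms `y₁, …, yₙ` of
degree `0` that commute with `d`: a `ℤ`-graded module with `p`-nilpotent `d` over
`k[y₁, …, yₙ] / (y₁ᵖ, …, yₙᵖ)`. -/
structure NilpotentActionComplex (p n : ℕ) (k : Type u) [Field k] extends NComplex.{u, u} p k where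
  y : Fin n → Module.End k carrier
  y_mem : ∀ (j : Fin n) (i : ℤ) (x : carrier), x ∈ grading i → y j x ∈ grading i
  y_comm : ∀ i j, Commute (y i) (y j)
  d_comm : ∀ i, Commute d (y i)
  y_pow : ∀ i, y i ^ p = 0

namespace NilpotentActionComplex

open MvPolynomial

variable {p n : ℕ} {k : Type u} [Field k] (V : NilpotentActionComplex p n k)

/-- The underlying module `A ⊗ V` of the `p`-DG module attached to `V`. -/
abbrev Ext : Type u := MvPolynomial (Fin n) k ⊗[k] V.carrier

/-- The total degree on `A ⊗ V`. -/
noncomputable def extGrading (i : ℤ) : Submodule k V.Ext :=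
  Submodule.span k {t | ∃ (a b : ℤ) (f : MvPolynomial (Fin n) k) (v : V.carrier),
    f ∈ polyGrading n k a ∧ v ∈ V.grading b ∧ a + b = i ∧ f ⊗ₜ[k] v = t}

variable {V} in
theorem tmul_mem_extGrading {a b i : ℤ} {f : MvPolynomial (Fin n) k} {v : V.carrier}
    (hf : f ∈ polyGrading n k a) (hv : v ∈ V.grading b) (h : a + b = i) :
    f ⊗ₜ[k] v ∈ V.extGrading i :=
  Submodule.subset_span ⟨a, b, f, v, hf, hv, h, rfl⟩

variable {V} in
theorem extGrading_le {i : ℤ} {S : Submodule k V.Ext}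
    (h : ∀ a b, ∀ f ∈ polyGrading n k a, ∀ v ∈ V.grading b, a + b = i → f ⊗ₜ[k] v ∈ S) :
    V.extGrading i ≤ S := by
  refine Submodule.span_le.2 ?_
  rintro _ ⟨a, b, f, v, hf, hv, hab, rfl⟩
  exact h a b f hf v hv hab

/-- A basis of `V` consisting of homogeneous elements, indexed by the degree and a basis of the
piece of that degree. -/
noncomputable def homogeneousBasis :
    Module.Basis (Σ i : ℤ, Module.Basis.ofVectorSpaceIndex k (V.grading i)) k V.carrier :=
  V.isInternal.collectedBasis fun i => Module.Basis.ofVectorSpace k (V.grading i)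

theorem homogeneousBasis_mem (j : Σ i : ℤ, Module.Basis.ofVectorSpaceIndex k (V.grading i)) :
    V.homogeneousBasis j ∈ V.grading j.1 :=
  V.isInternal.collectedBasis_mem _ j

theorem extGrading_iSupIndep : iSupIndep V.extGrading := by
  let B := (basisMonomials (Fin n) k).tensorProduct V.homogeneousBasis
  refine iSupIndep_of_repr_apply_eq_zero B
    (fun q => Finsupp.weight (fun _ : Fin n => (-1 : ℤ)) q.1 + q.2.1) fun i x hx q hq => ?_
  suffices V.extGrading i ≤ LinearMap.ker (B.coord q) from this hx
  refine extGrading_le fun a b f hf v hv hab => ?_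
  rw [LinearMap.mem_ker, Module.Basis.coord_apply, Module.Basis.tensorProduct_repr_tmul_apply,
    smul_eq_mul]
  rcases eq_or_ne b q.2.1 with rfl | hb
  · have hcoeff : f.coeff q.1 = 0 := by
      by_contra h0
      exact hq (by rw [hf h0, hab])
    exact mul_eq_zero_of_right _ hcoeff
  · exact mul_eq_zero_of_left (V.isInternal.collectedBasis_repr_of_mem_ne _ hb hv) _

theorem iSup_extGrading : ⨆ i, V.extGrading i = ⊤ := by
  rw [eq_top_iff]
  rintro t -
  induction t using TensorProduct.induction_on with
  | zero => exact zero_mem _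
  | add x y hx hy => exact add_mem hx hy
  | tmul f v =>
    have hv : v ∈ ⨆ i, V.grading i := V.isInternal.submodule_iSup_eq_top ▸ Submodule.mem_top
    induction hv using Submodule.iSup_induction' with
    | zero => rw [TensorProduct.tmul_zero]; exact zero_mem _
    | add x y _ _ hx hy => rw [TensorProduct.tmul_add]; exact add_mem hx hy
    | mem b v hv =>
      induction f using MvPolynomial.induction_on' with
      | add f g hf hg => rw [TensorProduct.add_tmul]; exact add_mem hf hg
      | monomial m c =>
        exact Submodule.mem_iSup_of_mem _ (tmul_mem_extGrading
          (isWeightedHomogeneous_monomial _ m c rfl) hv rfl)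

theorem extGrading_isInternal : DirectSum.IsInternal V.extGrading :=
  DirectSum.isInternal_submodule_of_iSupIndep_of_iSup_eq_top V.extGrading_iSupIndep
    V.iSup_extGrading

theorem smul_mem_extGrading {i j : ℤ} {f : MvPolynomial (Fin n) k} {t : V.Ext}
    (hf : f ∈ polyGrading n k i) (ht : t ∈ V.extGrading j) : f • t ∈ V.extGrading (i + j) := by
  suffices V.extGrading j ≤ (V.extGrading (i + j)).comap (Algebra.lsmul k k V.Ext f) from this ht
  refine extGrading_le fun a b g hg v hv hab => ?_
  exact tmul_mem_extGrading (hf.mul hg) hv (by omega)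

/-- The differential `d + ∑ xᵢ yᵢ` on `A ⊗ V`. -/
noncomputable def extD : Module.End (MvPolynomial (Fin n) k) V.Ext :=
  V.d.baseChange (MvPolynomial (Fin n) k) +
    ∑ i, (X i : MvPolynomial (Fin n) k) • (V.y i).baseChange (MvPolynomial (Fin n) k)

theorem extD_tmul (f : MvPolynomial (Fin n) k) (v : V.carrier) :
    V.extD (f ⊗ₜ v) = f ⊗ₜ V.d v + ∑ i, (X i * f) ⊗ₜ V.y i v := by
  simp [extD, TensorProduct.smul_tmul']

theorem extD_mem {i : ℤ} {t : V.Ext} (ht : t ∈ V.extGrading i) :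
    V.extD t ∈ V.extGrading (i - 1) := by
  suffices V.extGrading i ≤ (V.extGrading (i - 1)).comap (V.extD.restrictScalars k) from this ht
  refine extGrading_le fun a b f hf v hv hab => ?_
  rw [Submodule.mem_comap, LinearMap.restrictScalars_apply, extD_tmul]
  refine add_mem (tmul_mem_extGrading hf (V.d_mem b v hv) (by omega)) (sum_mem fun j _ => ?_)
  exact tmul_mem_extGrading ((isWeightedHomogeneous_X k _ j).mul hf) (V.y_mem j b v hv)
    (by omega)

/-- The map `A ⊗ V → V` that evaluates polynomials at the origin. -/
noncomputable def extEval : V.Ext →ₗ[k] V.carrier :=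
  TensorProduct.lift (LinearMap.lsmul k V.carrier ∘ₗ lcoeff k 0)

theorem extEval_tmul (f : MvPolynomial (Fin n) k) (v : V.carrier) :
    V.extEval (f ⊗ₜ v) = constantCoeff f • v := rfl

theorem extEval_smul (f : MvPolynomial (Fin n) k) (t : V.Ext) :
    V.extEval (f • t) = constantCoeff f • V.extEval t := by
  induction t using TensorProduct.induction_on with
  | zero => rw [smul_zero, map_zero, smul_zero]
  | add x y hx hy => rw [smul_add, map_add, hx, hy, map_add, smul_add]
  | tmul g v =>
    rw [TensorProduct.smul_tmul', extEval_tmul, extEval_tmul, smul_eq_mul, map_mul, mul_smul]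

/-- The filtration of `A ⊗ V` induced by the filtration of `V` by degree. -/
noncomputable def extFiltration (j : ℤ) : Submodule (MvPolynomial (Fin n) k) V.Ext :=
  (⨆ i ≤ j, V.grading i).baseChange (MvPolynomial (Fin n) k)

theorem extFiltration_monotone : Monotone V.extFiltration := fun _ _ hij =>
  Submodule.baseChange_mono _ (biSup_mono fun _ hl => hl.trans hij)

theorem extFiltration_eq_bot {a : ℤ} (ha : ∀ i ≤ a, V.grading i = ⊥) : V.extFiltration a = ⊥ := by
  rw [extFiltration, iSup₂_eq_bot.2 ha, Submodule.baseChange_bot]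

theorem extFiltration_eq_top {b : ℤ} (hb : ∀ i, b < i → V.grading i = ⊥) :
    V.extFiltration b = ⊤ := by
  suffices ⨆ i ≤ b, V.grading i = ⊤ by rw [extFiltration, this, Submodule.baseChange_top]
  refine eq_top_iff.2 (V.isInternal.submodule_iSup_eq_top.ge.trans (iSup_le fun i => ?_))
  rcases le_or_gt i b with hi | hi
  · exact le_iSup₂ (f := fun i (_ : i ≤ b) => V.grading i) i hi
  · exact (hb i hi).trans_le bot_le

theorem baseChange_mem_loweringEnd_extFiltration {f : Module.End k V.carrier} {c : ℤ}
    (hf : ∀ i, ∀ v ∈ V.grading i, f v ∈ V.grading (i - c)) :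
    f.baseChange (MvPolynomial (Fin n) k) ∈ loweringEnd V.extFiltration c :=
  baseChange_mem_loweringEnd _ (mem_loweringEnd_iSup_le hf)

theorem extD_mem_loweringEnd : V.extD ∈ loweringEnd V.extFiltration 0 := by
  have hd := V.baseChange_mem_loweringEnd_extFiltration V.d_mem
  refine add_mem (mem_loweringEnd.2 fun j x hx => ?_) (sum_mem fun j _ =>
    Submodule.smul_mem _ _ (V.baseChange_mem_loweringEnd_extFiltration ?_))
  · exact V.extFiltration_monotone (by omega) (mem_loweringEnd.1 hd j x hx)
  · simpa only [sub_zero] using V.y_mem j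

theorem lie_extD_baseChange (f : Module.End k V.carrier) :
    ⁅V.extD, f.baseChange (MvPolynomial (Fin n) k)⁆ =
      ⁅V.d, f⁆.baseChange (MvPolynomial (Fin n) k) +
        ∑ j, (X j : MvPolynomial (Fin n) k) • ⁅V.y j, f⁆.baseChange (MvPolynomial (Fin n) k) :=
  (lie_add_sum_smul Finset.univ X (fun j => (V.y j).baseChange _) (V.d.baseChange _)
    (f.baseChange _)).trans (congrArg₂ (· + ·) (lie_baseChange V.d f)
      (Finset.sum_congr rfl fun j _ => congrArg _ (lie_baseChange (V.y j) f)))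

variable [Fact p.Prime] [CharP k p]

theorem extD_pow : V.extD ^ p = 0 := by
  have hp : (p : Module.End (MvPolynomial (Fin n) k) V.Ext) = 0 := by
    rw [← map_natCast (algebraMap (MvPolynomial (Fin n) k) _), CharP.cast_eq_zero, map_zero]
  have hcomm {f g : Module.End k V.carrier} (h : Commute f g) :
      Commute (f.baseChange (MvPolynomial (Fin n) k)) (g.baseChange (MvPolynomial (Fin n) k)) :=
    h.map (Module.End.baseChangeHom k (MvPolynomial (Fin n) k) V.carrier)
  refine add_pow_prime_eq_zero hp
    (Commute.sum_right _ _ _ fun i _ => (hcomm (V.d_comm i)).smul_right _) ?_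
    (sum_pow_prime_eq_zero hp _
      (fun i j => ((hcomm (V.y_comm i j)).smul_left _).smul_right _) fun i => ?_)
  · rw [← LinearMap.baseChange_pow, V.d_pow, LinearMap.baseChange_zero]
  · rw [smul_pow, ← LinearMap.baseChange_pow, V.y_pow, LinearMap.baseChange_zero, smul_zero]

/-- The `p`-DG module `A ⊗ V` with differential `d + ∑ xᵢ yᵢ`. -/
noncomputable def toPDGModule : PDGModule.{u, u} p n k where
  carrier := V.Ext
  grading := V.extGrading
  isInternal := V.extGrading_isInternal
  smul_mem _ _ _ _ hf ht := V.smul_mem_extGrading hf ht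
  d := V.extD
  d_mem _ _ ht := V.extD_mem ht
  d_pow := V.extD_pow

theorem toPDGModule_isFree : V.toPDGModule.IsFree := by
  refine ⟨_, V.homogeneousBasis.baseChange (MvPolynomial (Fin n) k), Sigma.fst, fun j => ?_⟩
  exact Module.Basis.baseChange_apply (MvPolynomial (Fin n) k) V.homogeneousBasis j ▸
    tmul_mem_extGrading (isWeightedHomogeneous_one k _) (V.homogeneousBasis_mem j)
    (zero_add _)

theorem toPDGModule_isFG [Module.Finite k V.carrier] : V.toPDGModule.IsFG :=
  inferInstanceAs (Module.Finite (MvPolynomial (Fin n) k) V.Ext)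

/-- The quotient map `A ⊗ V → (A ⊗ V) ⊗_A k`, with its domain written as a tensor product. -/
noncomputable def extToFiber : V.Ext →ₗ[k] V.toPDGModule.Fiber := V.toPDGModule.toFiber

theorem extToFiber_eq_zero_iff (t : V.Ext) : V.extToFiber t = 0 ↔
    t ∈ augIdeal n k • (⊤ : Submodule (MvPolynomial (Fin n) k) V.Ext) :=
  V.toPDGModule.toFiber_eq_zero_iff t

theorem extToFiber_surjective : Function.Surjective V.extToFiber :=
  V.toPDGModule.toFiber_surjective

/-- The map `V → (A ⊗ V) ⊗_A k`, which is an isomorphism. -/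
noncomputable def toExtFiber : V.carrier →ₗ[k] V.toPDGModule.Fiber :=
  V.extToFiber ∘ₗ TensorProduct.mk k (MvPolynomial (Fin n) k) V.carrier 1

theorem extToFiber_tmul (f : MvPolynomial (Fin n) k) (v : V.carrier) :
    V.extToFiber (f ⊗ₜ v) = constantCoeff f • V.toExtFiber v := by
  have hf : (f - C (constantCoeff f)) • (1 ⊗ₜ v : V.Ext) ∈
      augIdeal n k • (⊤ : Submodule (MvPolynomial (Fin n) k) V.Ext) :=
    Submodule.smul_mem_smul (mem_augIdeal_iff.2 (by simp)) trivial
  have hsub : (f - C (constantCoeff f)) • (1 ⊗ₜ v : V.Ext) =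
      f ⊗ₜ v - constantCoeff f • (1 ⊗ₜ v : V.Ext) := by
    rw [TensorProduct.smul_tmul', TensorProduct.smul_tmul', smul_eq_mul, mul_one,
      smul_eq_C_mul, mul_one, TensorProduct.sub_tmul]
  rw [← extToFiber_eq_zero_iff, hsub, map_sub, map_smul, sub_eq_zero] at hf
  exact hf

theorem toExtFiber_injective : Function.Injective V.toExtFiber := by
  refine (injective_iff_map_eq_zero _).2 fun v hv => ?_
  have heval : ∀ t ∈ augIdeal n k • (⊤ : Submodule (MvPolynomial (Fin n) k) V.Ext),
      V.extEval t = 0 := fun t ht => by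
    induction ht using Submodule.smul_induction_on' with
    | smul f hf t _ => rw [extEval_smul, mem_augIdeal_iff.1 hf, zero_smul]
    | add x _ y _ hx hy => rw [map_add, hx, hy, add_zero]
  have hv' := heval (1 ⊗ₜ v) ((V.extToFiber_eq_zero_iff _).1 hv)
  rwa [extEval_tmul, map_one, one_smul] at hv'

theorem toExtFiber_surjective : Function.Surjective V.toExtFiber := by
  rw [← LinearMap.range_eq_top, eq_top_iff]
  intro t _
  obtain ⟨t, rfl⟩ := V.extToFiber_surjective t
  induction t using TensorProduct.induction_on with
  | zero => exact map_zero V.extToFiber ▸ zero_mem _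
  | add x y hx hy => exact map_add V.extToFiber x y ▸ add_mem (hx trivial) (hy trivial)
  | tmul f v => exact V.extToFiber_tmul f v ▸ Submodule.smul_mem _ _ ⟨v, rfl⟩

theorem toExtFiber_d (v : V.carrier) :
    V.toExtFiber (V.d v) = V.toPDGModule.fiberD (V.toExtFiber v) := by
  change V.toExtFiber (V.d v) = V.extToFiber (V.extD (1 ⊗ₜ v))
  simp [extD_tmul, extToFiber_tmul]

theorem toExtFiber_mem_fiberGrading_iff (i : ℤ) (v : V.carrier) :
    V.toExtFiber v ∈ V.toPDGModule.fiberGrading i ↔ v ∈ V.grading i := by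
  constructor
  · suffices V.extGrading i ≤ ((V.grading i).map V.toExtFiber).comap V.extToFiber by
      rintro ⟨t, ht, hv⟩
      obtain ⟨w, hw, hwt⟩ := this ht
      rwa [← V.toExtFiber_injective (hwt.trans hv)]
    refine extGrading_le fun a b f hf w hw hab => ?_
    rw [Submodule.mem_comap, extToFiber_tmul]
    by_cases hcoeff : f.coeff 0 = 0
    · rw [constantCoeff_eq, hcoeff, zero_smul]
      exact zero_mem _
    · have ha : (0 : ℤ) = a := (map_zero (Finsupp.weight fun _ : Fin n => (-1 : ℤ))).symm.trans
        (hf hcoeff)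
      exact Submodule.smul_mem _ _ ⟨w, by rwa [← hab, ← ha, zero_add], rfl⟩
  · exact fun hv =>
      ⟨1 ⊗ₜ v, tmul_mem_extGrading (isWeightedHomogeneous_one k _) hv (zero_add i), rfl⟩

/-- The fiber of the `p`-DG module `A ⊗ V` is `V`. -/
noncomputable def fiberEquiv : NComplex.Equiv V.toNComplex V.toPDGModule.fiber where
  toLinearEquiv := LinearEquiv.ofBijective V.toExtFiber
    ⟨V.toExtFiber_injective, V.toExtFiber_surjective⟩
  map_d := V.toExtFiber_d
  mem_grading_iff := V.toExtFiber_mem_fiberGrading_iff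

theorem exists_X_pow_smul_mem_range {a b : ℤ} (hV : ∀ j, j < a ∨ b < j → V.grading j = ⊥)
    {i : Fin n} {D : Module.End k V.carrier}
    (hD : ∀ j, ∀ v ∈ V.grading j, D v ∈ V.grading j)
    (hy : ∀ j, ⁅D, V.y j⁆ = (Pi.single i 1 : Fin n → Module.End k V.carrier) j) :
    ∃ N : ℕ, ∀ s ≤ p, ∀ z, (V.extD ^ s) z = 0 →
      (X i : MvPolynomial (Fin n) k) ^ N • z ∈ LinearMap.range (V.extD ^ (p - s)) := by
  refine exists_pow_smul_mem_range (CharP.cast_eq_zero _ p) V.extFiltration_monotone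
    (V.extFiltration_eq_bot fun j hj => hV j (.inl (Int.lt_of_le_sub_one hj)))
    (V.extFiltration_eq_top fun j hj => hV j (.inr hj)) V.extD_pow V.extD_mem_loweringEnd
    (V.baseChange_mem_loweringEnd_extFiltration (f := -D) fun j v hv => ?_) ?_
  · simpa only [LinearMap.neg_apply, sub_zero, neg_mem_iff] using hD j v hv
  have hlie (f : Module.End k V.carrier) : ⁅f, -D⁆ = ⁅D, f⁆ := by
    rw [Ring.lie_def, Ring.lie_def, mul_neg, neg_mul, sub_neg_eq_add, neg_add_eq_sub]
  have hX : ∑ j, (X j : MvPolynomial (Fin n) k) • ⁅V.y j, -D⁆.baseChange (MvPolynomial (Fin n) k) =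
      algebraMap (MvPolynomial (Fin n) k) (Module.End _ V.Ext) (X i) := by
    rw [Finset.sum_eq_single i]
    · rw [hlie, hy, Pi.single_eq_same, LinearMap.baseChange_one,
        Algebra.algebraMap_eq_smul_one]
    · intro j _ hj
      rw [hlie, hy, Pi.single_eq_of_ne hj, LinearMap.baseChange_zero, smul_zero]
    · exact fun h => absurd (Finset.mem_univ i) h
  rw [lie_extD_baseChange, hX]
  refine (add_sub_cancel_right (⁅V.d, -D⁆.baseChange (MvPolynomial (Fin n) k)) _).symm ▸ ?_
  refine V.baseChange_mem_loweringEnd_extFiltration fun j v hv => ?_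
  rw [hlie, Ring.lie_def]
  exact sub_mem (hD _ _ (V.d_mem j v hv)) (V.d_mem j _ (hD j v hv))

theorem totalHomology_toPDGModule_finite [Module.Finite k V.carrier] {a b : ℤ}
    (hV : ∀ j, j < a ∨ b < j → V.grading j = ⊥)
    (hy : ∀ i, ∃ D : Module.End k V.carrier, (∀ j, ∀ v ∈ V.grading j, D v ∈ V.grading j) ∧
      ∀ j, ⁅D, V.y j⁆ = (Pi.single i 1 : Fin n → Module.End k V.carrier) j)
    {s : ℕ} (hs : s ≤ p) : Module.Finite k (V.toPDGModule.toNComplex.totalHomology s) := by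
  refine V.toPDGModule.totalHomology_finite V.toPDGModule_isFG hs fun i => ?_
  obtain ⟨D, hD, hyD⟩ := hy i
  obtain ⟨N, hN⟩ := V.exists_X_pow_smul_mem_range hV hD hyD
  exact ⟨N, hN s hs⟩

end NilpotentActionComplex

theorem exists_connection {k R P : Type*} [CommRing k] [CommRing R] [Algebra k R] [AddCommGroup P]
    [Module k P] [Module R P] [IsScalarTower k R P] [Module.Projective R P]
    (δ : Derivation k R R) : ∃ D : P →ₗ[k] P, ∀ (r : R) (x : P), D (r • x) = r • D x + δ r • x := by
  obtain ⟨σ, hσ⟩ := Module.projective_def'.1 (inferInstance : Module.Projective R P)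
  have hσ_apply (x : P) : Finsupp.linearCombination R id (σ x) = x := LinearMap.congr_fun hσ x
  refine ⟨(Finsupp.linearCombination R id).restrictScalars k ∘ₗ
    Finsupp.mapRange.linearMap δ.toLinearMap ∘ₗ σ.restrictScalars k, fun r x => ?_⟩
  have leibniz : Finsupp.mapRange.linearMap δ.toLinearMap (r • σ x) =
      r • Finsupp.mapRange.linearMap δ.toLinearMap (σ x) + δ r • σ x := by
    ext y
    simp [mul_comm]
  simp only [LinearMap.comp_apply, LinearMap.restrictScalars_apply, map_smul, leibniz, map_add,
    hσ_apply]

theorem isInternal_range_lof {ι K : Type*} [DecidableEq ι] [Ring K] (M : ι → Type*)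
    [∀ i, AddCommGroup (M i)] [∀ i, Module K (M i)] :
    DirectSum.IsInternal fun i => LinearMap.range (DirectSum.lof K ι M i) := by
  refine DirectSum.isInternal_submodule_of_iSupIndep_of_iSup_eq_top (fun i => ?_)
    DFinsupp.iSup_range_lsingle
  rw [Submodule.disjoint_def]
  rintro _ ⟨x, rfl⟩ hx
  have hker : ⨆ j, ⨆ (_ : j ≠ i), LinearMap.range (DirectSum.lof K ι M j) ≤
      LinearMap.ker (DirectSum.component K ι M i) := by
    refine iSup₂_le fun j hj => ?_
    rintro _ ⟨y, rfl⟩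
    rw [LinearMap.mem_ker, DirectSum.component.of, dif_neg hj]
  have hzero := hker hx
  rw [LinearMap.mem_ker, DirectSum.component.lof_self] at hzero
  rw [hzero, map_zero]

theorem NComplex.finite_of_grading_eq_bot {N : ℕ} {k : Type u} [Field k] (C : NComplex.{u, v} N k)
    {a b : ℤ} (hC : ∀ i, i < a ∨ b < i → C.grading i = ⊥)
    (hfin : ∀ i, Module.Finite k (C.grading i)) : Module.Finite k C.carrier := by
  have hsup : ⨆ i ∈ Finset.Icc a b, C.grading i = ⊤ := by
    refine eq_top_iff.2 (C.isInternal.submodule_iSup_eq_top.ge.trans (iSup_le fun i => ?_))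
    by_cases hi : i ∈ Finset.Icc a b
    · exact le_iSup₂_of_le i hi le_rfl
    · exact (hC i (by rw [Finset.mem_Icc] at hi; omega)).trans_le bot_le
  rw [Module.finite_def, ← hsup]
  exact Submodule.fg_biSup _ _ fun i _ => Module.Finite.iff_fg.1 (hfin i)

section Stretch

/-- The function `m ↦ ⌊m / p⌋ + ⌈m / p⌉`, which takes every even value once and every odd value
`p - 1` times. Repeating modules according to it turns chain complexes into `p`-complexes. -/
def stretch (p : ℕ) (m : ℤ) : ℤ := m / p - (-m) / p

theorem stretch_mono (p : ℕ) : Monotone (stretch p) := by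
  rcases p.eq_zero_or_pos with rfl | hp
  · simp [Monotone, stretch]
  · have hp' : (0 : ℤ) < p := by exact_mod_cast hp
    exact fun _ _ h => sub_le_sub (Int.ediv_le_ediv hp' h) (Int.ediv_le_ediv hp' (neg_le_neg h))

variable {p : ℕ}

theorem stretch_mul_add (hp : 0 < p) (q r : ℤ) : stretch p (p * q + r) = 2 * q + stretch p r := by
  have hp' : (p : ℤ) ≠ 0 := by exact_mod_cast hp.ne'
  rw [stretch, stretch, neg_add, ← mul_neg, Int.mul_add_ediv_left _ _ hp',
    Int.mul_add_ediv_left _ _ hp']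
  ring

theorem stretch_mul (hp : 0 < p) (q : ℤ) : stretch p (p * q) = 2 * q := by
  simpa [stretch] using stretch_mul_add hp q 0

theorem stretch_add_self (hp : 0 < p) (m : ℤ) : stretch p (m + p) = stretch p m + 2 := by
  simpa [add_comm] using stretch_mul_add hp 1 m

theorem stretch_add_sub_eq (hp : 0 < p) {m s : ℤ}
    (hm : stretch p (m - s) = stretch p m - 1) :
    stretch p (m + p - s) = stretch p m + 1 := by
  rw [add_sub_right_comm, stretch_add_self hp, hm]
  ring

theorem stretch_of_pos {r : ℤ} (h0 : 0 < r) (hr : r < p) : stretch p r = 1 := by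
  have hneg : (-r) / (p : ℤ) = -1 := by
    rw [Int.ediv_eq_iff_of_pos (by omega)]
    constructor <;> linarith
  rw [stretch, Int.ediv_eq_zero_of_lt h0.le hr, hneg, sub_neg_eq_add, zero_add]

theorem exists_stretch_eq {s : ℤ} (hs : 0 < s) (hsp : s < p) (i : ℤ) :
    ∃ m, stretch p m = i ∧ stretch p (m - s) = i - 1 := by
  have hp : 0 < p := by omega
  obtain ⟨q, rfl | rfl⟩ := Int.even_or_odd' i
  · refine ⟨p * q, stretch_mul hp q, ?_⟩
    rw [show (p : ℤ) * q - s = p * (q - 1) + (p - s) by ring, stretch_mul_add hp,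
      stretch_of_pos (by omega) (by omega)]
    ring
  · refine ⟨p * q + s, ?_, ?_⟩
    · rw [stretch_mul_add hp, stretch_of_pos hs hsp]
    · rw [add_sub_cancel_right, stretch_mul hp, add_sub_cancel_right]

theorem eq_of_stretch_eq {m m' : ℤ} (h : stretch p (m - 1) < stretch p m)
    (h' : stretch p (m' - 1) < stretch p m') (heq : stretch p m = stretch p m') : m = m' := by
  rcases lt_trichotomy m m' with hlt | rfl | hlt
  · have := stretch_mono p (Int.le_sub_one_of_lt hlt)
    omega
  · rfl
  · have := stretch_mono p (Int.le_sub_one_of_lt hlt)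
    omega

end Stretch

section Transition

open CategoryTheory Limits

variable {𝒞 : Type*} [Category 𝒞] [HasZeroMorphisms 𝒞] (C : ChainComplex 𝒞 ℤ)

/-- The identity of `C.X a` if `a = b`, and the differential otherwise: the maps between the terms
of the sequence obtained from `C` by repeating terms. -/
noncomputable def transition (a b : ℤ) : C.X a ⟶ C.X b :=
  if h : a = b then eqToHom (congrArg C.X h) else C.d a b

@[simp]
theorem transition_self (a : ℤ) : transition C a a = 𝟙 (C.X a) :=
  dif_pos rfl

theorem transition_of_ne {a b : ℤ} (h : a ≠ b) : transition C a b = C.d a b :=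
  dif_neg h

theorem transition_comp_transition {a b c : ℤ} (hab : b ≤ a) (hbc : c ≤ b) :
    transition C a b ≫ transition C b c = transition C a c := by
  rcases hab.eq_or_lt with rfl | hab
  · simp
  rcases hbc.eq_or_lt with rfl | hbc
  · simp
  rw [transition_of_ne C hab.ne', transition_of_ne C hbc.ne', C.d_comp_d,
    transition_of_ne C (hbc.trans hab).ne', C.shape a c (by simp; omega)]

theorem transition_eq_zero {a b : ℤ} (h : b + 1 < a) : transition C a b = 0 := by
  rw [transition_of_ne C (by omega), C.shape a b (by simp; omega)]

end Transition

section Stretched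

open CategoryTheory

variable {R : Type u} [Ring R] (p : ℕ) (C : ChainComplex (ModuleCat.{u} R) ℤ)

/-- The total module of the sequence obtained from `C` by repeating the terms of odd degree `p - 1`
times. -/
abbrev StretchedModule : Type u := ⨁ m : ℤ, C.X (stretch p m)

/-- The inclusion of the `m`-th term of the repeated sequence. -/
noncomputable abbrev stretchedLof (m : ℤ) : C.X (stretch p m) →ₗ[R] StretchedModule p C :=
  DirectSum.lof R ℤ (fun m => C.X (stretch p m)) m

/-- The endomorphism of `StretchedModule p C` given by the transition maps. -/
noncomputable def stretchedD : Module.End R (StretchedModule p C) :=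
  DirectSum.toModule R ℤ _ fun m =>
    stretchedLof p C (m - 1) ∘ₗ (transition C (stretch p m) (stretch p (m - 1))).hom

theorem stretchedLof_injective (m : ℤ) : Function.Injective (stretchedLof p C m) :=
  DirectSum.of_injective m

theorem stretchedD_lof (m : ℤ) (x : C.X (stretch p m)) :
    stretchedD p C (stretchedLof p C m x) =
      stretchedLof p C (m - 1) (transition C (stretch p m) (stretch p (m - 1)) x) := by
  rw [stretchedD, DirectSum.toModule_lof]
  rfl

theorem stretchedD_pow_lof {l : ℕ} {m m' : ℤ} (h : m' = m - l) (x : C.X (stretch p m)) :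
    (stretchedD p C ^ l) (stretchedLof p C m x) =
      stretchedLof p C m' (transition C (stretch p m) (stretch p m') x) := by
  induction l generalizing m' with
  | zero =>
    obtain rfl : m' = m := by simpa using h
    simp
  | succ l ih =>
    obtain rfl : m' = (m - l) - 1 := by rw [h]; push_cast; ring
    rw [pow_succ', Module.End.mul_apply, ih rfl, stretchedD_lof, ← ModuleCat.comp_apply,
      transition_comp_transition C (stretch_mono p (by omega)) (stretch_mono p (by omega))]

variable {p}

theorem stretchedD_pow (hp : 0 < p) : stretchedD p C ^ p = 0 := by
  refine DirectSum.linearMap_ext R fun m => LinearMap.ext fun x => ?_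
  have hm : stretch p m = stretch p (m - p) + 2 := by
    rw [← stretch_add_self hp, sub_add_cancel]
  rw [LinearMap.comp_apply, stretchedD_pow_lof p C rfl, transition_eq_zero C (by omega)]
  simp

end Stretched

section StretchedComplex

open CategoryTheory
open scoped ModuleCat

variable (k : Type u) [Field k] {R : Type u} [Ring R] [Algebra k R] {p : ℕ} (hp : 0 < p)
  (C : ChainComplex (ModuleCat.{u} R) ℤ)

/-- The `p`-complex obtained from a chain complex by repeating the terms of odd degree `p - 1`
times. -/
noncomputable def stretched : NComplex.{u, u} p k where
  carrier := StretchedModule p C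
  grading m := (LinearMap.range (stretchedLof p C m)).restrictScalars k
  isInternal := isInternal_range_lof (K := R) fun m => C.X (stretch p m)
  d := (stretchedD p C).restrictScalars k
  d_mem := by
    rintro m _ ⟨x, rfl⟩
    exact ⟨_, (stretchedD_lof p C m x).symm⟩
  d_pow := LinearMap.ext fun x => (restrictScalars_pow_apply k _ p x).trans
    (LinearMap.congr_fun (stretchedD_pow C hp) x)

/-- The inclusion of the `m`-th term of the repeated sequence. -/
noncomputable def stretchedIncl (m : ℤ) : C.X (stretch p m) →ₗ[k] (stretched k hp C).carrier :=
  (stretchedLof p C m).restrictScalars k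

theorem stretchedIncl_injective (m : ℤ) : Function.Injective (stretchedIncl k hp C m) :=
  stretchedLof_injective p C m

variable {C}

theorem stretched_d_pow_stretchedIncl {l : ℕ} {m m' : ℤ} (h : m' = m - l) (x : C.X (stretch p m)) :
    ((stretched k hp C).d ^ l) (stretchedIncl k hp C m x) =
      stretchedIncl k hp C m' (transition C (stretch p m) (stretch p m') x) :=
  (restrictScalars_pow_apply k (stretchedD p C) l _).trans (stretchedD_pow_lof p C h x)

variable {k hp}

theorem stretchedIncl_mem_cycles_iff {s : ℕ} {m : ℤ} {x : C.X (stretch p m)} :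
    stretchedIncl k hp C m x ∈ (stretched k hp C).cycles s m ↔
      transition C (stretch p m) (stretch p (m - s)) x = 0 := by
  have h : stretchedIncl k hp C m x ∈ LinearMap.ker ((stretched k hp C).d ^ s) ↔
      transition C (stretch p m) (stretch p (m - s)) x = 0 := by
    rw [LinearMap.mem_ker, stretched_d_pow_stretchedIncl k hp rfl,
      (stretchedIncl_injective k hp C _).eq_iff' (map_zero _)]
  exact ⟨fun hx => h.1 hx.2, fun hx => ⟨⟨x, rfl⟩, h.2 hx⟩⟩

theorem stretchedIncl_mem_boundaries_iff {s : ℕ} (hs : s ≤ p) {m : ℤ} {x : C.X (stretch p m)} :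
    stretchedIncl k hp C m x ∈ (stretched k hp C).boundaries s m ↔
      ∃ y, transition C (stretch p (m + p - s)) (stretch p m) y = x := by
  have h (y : C.X (stretch p (m + p - s))) :=
    stretched_d_pow_stretchedIncl k hp (show m = m + p - s - (p - s : ℕ) by omega) y
  constructor
  · rintro ⟨_, ⟨y, rfl⟩, hy⟩
    exact ⟨y, stretchedIncl_injective k hp C m ((h y).symm.trans hy)⟩
  · rintro ⟨y, rfl⟩
    exact ⟨_, ⟨y, rfl⟩, h y⟩

theorem stretchedIncl_mem_cycles_iff_d_eq_zero {s : ℕ} {m : ℤ}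
    (hm : stretch p (m - s) = stretch p m - 1) {x : C.X (stretch p m)} :
    stretchedIncl k hp C m x ∈ (stretched k hp C).cycles s m ↔
      C.d (stretch p m) (stretch p (m - s)) x = 0 := by
  rw [stretchedIncl_mem_cycles_iff, transition_of_ne C (by omega)]

theorem stretchedIncl_mem_boundaries_iff_exists_d_eq {s : ℕ} (hs : s ≤ p) {m : ℤ}
    (hm : stretch p (m - s) = stretch p m - 1) {x : C.X (stretch p m)} :
    stretchedIncl k hp C m x ∈ (stretched k hp C).boundaries s m ↔
      ∃ y, C.d (stretch p (m + p - s)) (stretch p m) y = x := by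
  rw [stretchedIncl_mem_boundaries_iff hs,
    transition_of_ne C (by rw [stretch_add_sub_eq hp hm]; omega)]

theorem exactAt_of_cycles_le_boundaries {s : ℕ} (hs : s ≤ p) {m : ℤ}
    (hm : stretch p (m - s) = stretch p m - 1)
    (h : (stretched k hp C).cycles s m ≤ (stretched k hp C).boundaries s m) :
    C.ExactAt (stretch p m) := by
  rw [C.exactAt_iff' (stretch p (m + p - s)) _ (stretch p (m - s))
    (by simp [stretch_add_sub_eq hp hm]) (by simp [hm]), ShortComplex.moduleCat_exact_iff]
  exact fun x hx => (stretchedIncl_mem_boundaries_iff_exists_d_eq hs hm).1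
    (h ((stretchedIncl_mem_cycles_iff_d_eq_zero hm).2 hx))

theorem eDim_homology_stretched {s : ℕ} (hs : s ≤ p) {m : ℤ}
    (hm : stretch p (m - s) = stretch p m - 1) :
    eDim k ((stretched k hp C).homology s m) =
      eDim k ((ModuleCat.restrictScalars (algebraMap k R)).obj (C.homology (stretch p m))) := by
  let S := C.sc' (stretch p (m + p - s)) (stretch p m) (stretch p (m - s))
  let r : LinearMap.ker S.g.hom →ₗ[k] (stretched k hp C).homology s m :=
    Submodule.mkQ _ ∘ₗ ((stretchedIncl k hp C m).restrict
      (p := (LinearMap.ker S.g.hom).restrictScalars k) fun x hx =>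
        (stretchedIncl_mem_cycles_iff_d_eq_zero hm).2 hx)
  have hr : Function.Surjective r := by
    refine (Submodule.mkQ_surjective _).comp ?_
    rintro ⟨_, ⟨x, rfl⟩, hx⟩
    exact ⟨⟨x, (stretchedIncl_mem_cycles_iff_d_eq_zero hm).1 ⟨⟨x, rfl⟩, hx⟩⟩, rfl⟩
  have hker : (LinearMap.range S.moduleCatToCycles).restrictScalars k = LinearMap.ker r := by
    ext z
    refine Iff.trans (exists_congr fun y => Subtype.ext_iff)
      ((stretchedIncl_mem_boundaries_iff_exists_d_eq (k := k) (hp := hp) hs hm).symm.trans ?_)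
    exact (LinearMap.mem_ker.trans (Submodule.Quotient.mk_eq_zero _)).symm
  let ι : S.homology ≅ C.homology (stretch p m) :=
    ShortComplex.homologyMapIso (C.isoSc' _ _ _
      (by simp [stretch_add_sub_eq hp hm]) (by simp [hm])).symm
  let q : (LinearMap.ker S.g.hom ⧸ LinearMap.range S.moduleCatToCycles) ≃ₗ[R]
      C.homology (stretch p m) :=
    (S.moduleCatHomologyIso.symm ≪≫ ι).toLinearEquiv
  let e := (r.quotKerEquivOfSurjective hr).symm ≪≫ₗ Submodule.quotEquivOfEq _ _ hker.symm ≪≫ₗ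
    Submodule.Quotient.restrictScalarsEquiv k _ ≪≫ₗ q.restrictScalars k
  exact congrArg Cardinal.toENat e.rank_eq

theorem eDim_homology_stretched_eq_zero {m : ℤ} (hm : stretch p (m - 1) = stretch p m) :
    eDim k ((stretched k hp C).homology 1 m) = 0 := by
  have hcycles : (stretched k hp C).cycles 1 m = ⊥ := by
    refine (Submodule.eq_bot_iff _).2 fun z hz => ?_
    obtain ⟨x, rfl⟩ := hz.1
    have hx := stretchedIncl_mem_cycles_iff.1 hz
    have hcomp := transition_comp_transition C (stretch_mono p (show m - (1 : ℕ) ≤ m by omega))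
      (show stretch p m ≤ stretch p (m - (1 : ℕ)) by rw [Nat.cast_one, hm])
    have hx_eq := ConcreteCategory.congr_hom hcomp x
    rw [ModuleCat.comp_apply, hx, map_zero, transition_self, ModuleCat.id_apply] at hx_eq
    rw [← hx_eq]
    exact map_zero (stretchedIncl k hp C m)
  have : Subsingleton ((stretched k hp C).cycles 1 m) :=
    Submodule.subsingleton_iff_eq_bot.2 hcycles
  rw [eDim, rank_subsingleton', map_zero]

theorem homologyDim_stretched (hp1 : 1 < p) :
    (stretched k hp C).homologyDim 1 = chainHomologyDim k C := by
  choose ψ hψ hψ_sub using exists_stretch_eq (p := p) one_pos (by exact_mod_cast hp1)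
  have hψ_lt (i : ℤ) : stretch p (ψ i - 1) = stretch p (ψ i) - 1 := by rw [hψ, hψ_sub]
  have hsupport : (Function.support fun m => eDim k ((stretched k hp C).homology 1 m)) ⊆
      Set.range ψ := by
    intro m hm
    have hne : stretch p (m - 1) ≠ stretch p m := fun h =>
      hm (eDim_homology_stretched_eq_zero h)
    have hle := stretch_mono p (show m - 1 ≤ m by omega)
    exact ⟨stretch p m, eq_of_stretch_eq (by rw [hψ_lt]; omega) (by omega) (hψ _)⟩
  rw [NComplex.homologyDim, chainHomologyDim,
    ← (Function.LeftInverse.injective hψ).tsum_eq hsupport]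
  refine tsum_congr fun i => ?_
  rw [eDim_homology_stretched hp1.le (by rw [Nat.cast_one, hψ_lt]), hψ]

theorem stretched_grading_eq_bot {a b : ℤ} (hC : ∀ i, i < a ∨ b < i → Limits.IsZero (C.X i))
    {m : ℤ} (hm : stretch p m < a ∨ b < stretch p m) : (stretched k hp C).grading m = ⊥ := by
  have := ModuleCat.subsingleton_of_isZero (hC _ hm)
  refine (Submodule.eq_bot_iff _).2 ?_
  rintro _ ⟨x, rfl⟩
  rw [Subsingleton.elim x 0]
  exact map_zero (stretchedIncl k hp C m)

theorem exists_stretched_grading_eq_bot (hp1 : 1 < p)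
    (hC : ∃ a b : ℤ, ∀ i, i < a ∨ b < i → Limits.IsZero (C.X i)) :
    ∃ a b : ℤ, ∀ m, m < a ∨ b < m → (stretched k hp C).grading m = ⊥ := by
  obtain ⟨a, b, hC⟩ := hC
  have hp1' : (1 : ℤ) < p := by exact_mod_cast hp1
  obtain ⟨a', ha', -⟩ := exists_stretch_eq one_pos hp1' (a - 1)
  obtain ⟨b', hb', -⟩ := exists_stretch_eq one_pos hp1' (b + 1)
  refine ⟨a', b', fun m hm => stretched_grading_eq_bot hC (hm.imp (fun h => ?_) fun h => ?_)⟩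
  · have := stretch_mono p h.le
    omega
  · have := stretch_mono p h.le
    omega

theorem finite_stretched_grading [Module.Finite k R] (m : ℤ) [Module.Finite R (C.X (stretch p m))] :
    Module.Finite k ((stretched k hp C).grading m) := by
  have := Module.Finite.trans (R := k) R (C.X (stretch p m))
  exact Module.Finite.range (stretchedIncl k hp C m)

end StretchedComplex

section StretchedAction

open CategoryTheory
open scoped ModuleCat

variable {p n : ℕ} [hp : Fact p.Prime] {k : Type u} [Field k] {R : Type u} [CommRing R]
  [Algebra k R] {y : Fin n → R} {C : ChainComplex (ModuleCat.{u} R) ℤ}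

variable (k C) in
/-- The `p`-complex `stretched k _ C` with the action of `p`-nilpotent elements of the base ring. -/
noncomputable def stretchedAction (hy : ∀ i, y i ^ p = 0) : NilpotentActionComplex p n k where
  toNComplex := stretched k hp.out.pos C
  y i := Algebra.lsmul k k (StretchedModule p C) (y i)
  y_mem := by
    rintro i m _ ⟨x, rfl⟩
    exact ⟨y i • x, map_smul (stretchedLof p C m) (y i) x⟩
  y_comm i j := (Commute.all (y i) (y j)).map (Algebra.lsmul k k (StretchedModule p C))
  d_comm i := LinearMap.ext fun (x : StretchedModule p C) => map_smul (stretchedD p C) (y i) x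
  y_pow i := (map_pow (Algebra.lsmul k k (StretchedModule p C)) (y i) p).symm.trans <| by
    rw [hy, map_zero]
    rfl

theorem exists_lie_stretchedAction_y (hy : ∀ i, y i ^ p = 0) {δ : Fin n → Derivation k R R}
    (hδ : ∀ i j, δ i (y j) = (Pi.single i 1 : Fin n → R) j)
    (hC : ∀ i, Module.Projective R (C.X i)) (i : Fin n) :
    ∃ D : Module.End k (stretchedAction k C hy).carrier,
      (∀ m, ∀ v ∈ (stretchedAction k C hy).grading m, D v ∈ (stretchedAction k C hy).grading m) ∧
      ∀ j, ⁅D, (stretchedAction k C hy).y j⁆ =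
        (Pi.single i 1 : Fin n → Module.End k (stretchedAction k C hy).carrier) j := by
  choose D hD using fun m => exists_connection (P := C.X (stretch p m)) (δ i)
  let D' : Module.End k (StretchedModule p C) := DirectSum.lmap D
  have leibniz (r : R) (x : StretchedModule p C) : D' (r • x) = r • D' x + δ i r • x := by
    induction x using DirectSum.induction_on with
    | zero => simp
    | add x x' hx hx' =>
      simp only [smul_add, map_add, hx, hx']
      abel
    | of m x =>
      have hsmul (r : R) (x : C.X (stretch p m)) :
          r • stretchedLof p C m x = stretchedLof p C m (r • x) :=
        (map_smul (stretchedLof p C m) r x).symm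
      have hD' (x : C.X (stretch p m)) :
          D' (stretchedLof p C m x) = stretchedLof p C m (D m x) :=
        DirectSum.lmap_lof D m x
      change D' (r • stretchedLof p C m x) =
        r • D' (stretchedLof p C m x) + δ i r • stretchedLof p C m x
      rw [hsmul, hsmul, hD', hD', hsmul, hD, map_add]
  refine ⟨D', ?_, fun j => ?_⟩
  · rintro m _ ⟨x, rfl⟩
    exact ⟨D m x, (DirectSum.lmap_lof D m x).symm⟩
  · refine LinearMap.ext fun (x : StretchedModule p C) => ?_
    refine (sub_eq_of_eq_add' (leibniz (y j) x)).trans ?_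
    rw [hδ]
    rcases eq_or_ne j i with rfl | hj
    · rw [Pi.single_eq_same, Pi.single_eq_same, one_smul]
      rfl
    · rw [Pi.single_eq_of_ne hj, Pi.single_eq_of_ne hj, zero_smul]
      rfl

theorem chainHomologyDim_mem_fiberHomologyDims [CharP k p] [Module.Finite k R]
    (hy : ∀ i, y i ^ p = 0) {δ : Fin n → Derivation k R R}
    (hδ : ∀ i j, δ i (y j) = (Pi.single i 1 : Fin n → R) j)
    (hC : IsPerfectComplex C) (hne : ¬ C.Acyclic) :
    chainHomologyDim k C ∈ fiberHomologyDims p n k := by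
  let V := stretchedAction k C hy
  have hp1 := hp.out.one_lt
  obtain ⟨a, b, hbot⟩ := exists_stretched_grading_eq_bot (k := k) (hp := hp.out.pos) hp1 hC.1
  have hfin : Module.Finite k V.carrier := V.finite_of_grading_eq_bot hbot fun m =>
    have := (hC.2 (stretch p m)).1
    finite_stretched_grading (hp := hp.out.pos) m
  refine ⟨V.toPDGModule, V.toPDGModule_isFree, V.toPDGModule_isFG, fun s hs hsp => ?_,
    fun s _ hsp => V.totalHomology_toPDGModule_finite hbot
      (exists_lie_stretchedAction_y hy hδ fun i => (hC.2 i).2) (by omega), ?_⟩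
  · obtain ⟨i, hi⟩ := not_forall.1 hne
    obtain ⟨m, rfl, hm⟩ := exists_stretch_eq (p := p) (s := s) (by omega) (by omega) i
    refine V.toPDGModule.fiber.totalHomology_nontrivial (i := m) s fun hle => hi ?_
    exact exactAt_of_cycles_le_boundaries (hp := hp.out.pos) (by omega) hm
      ((V.fiberEquiv.cycles_le_boundaries_iff s m).1 hle)
  · exact (homologyDim_stretched (hp := hp.out.pos) hp1).symm.trans (V.fiberEquiv.homologyDim_eq 1)

end StretchedAction

section GroupRing

variable {k G : Type*} [CommRing k] [CommMonoid G]

/-- The linear endomorphism of the monoid algebra `k[G]` which multiplies each `g : G` by the scalar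
`χ g`. -/
noncomputable def weightMap (χ : G → k) : Module.End k (MonoidAlgebra k G) :=
  (MonoidAlgebra.basis G k).constr k fun g => χ g • MonoidAlgebra.of k G g

theorem weightMap_of (χ : G → k) (g : G) :
    weightMap χ (MonoidAlgebra.of k G g) = χ g • MonoidAlgebra.of k G g := by
  rw [MonoidAlgebra.of_apply, ← MonoidAlgebra.basis_apply]
  exact Module.Basis.constr_basis _ _ _ _

theorem weightMap_mul {χ : G → k} (hχ : ∀ g h, χ (g * h) = χ g + χ h) (a b : MonoidAlgebra k G) :
    weightMap χ (a * b) = a • weightMap χ b + b • weightMap χ a := by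
  simp only [smul_eq_mul]
  induction a using MonoidAlgebra.induction_on with
  | of g =>
    induction b using MonoidAlgebra.induction_on with
    | of h =>
      rw [← map_mul, weightMap_of, weightMap_of, weightMap_of, hχ, mul_smul_comm, mul_smul_comm,
        ← map_mul, ← map_mul, mul_comm h g, add_smul, add_comm]
    | add x y hx hy =>
      simp only [mul_add, add_mul, map_add, hx, hy]
      abel
    | smul r x hx => simp only [mul_smul_comm, smul_mul_assoc, map_smul, hx, smul_add]
  | add x y hx hy =>
    simp only [mul_add, add_mul, map_add, hx, hy]
    abel
  | smul r x hx => simp only [mul_smul_comm, smul_mul_assoc, map_smul, hx, smul_add]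

end GroupRing

namespace ElemAbGroupRing

variable (p n : ℕ) (k : Type u) [Field k]

/-- The `i`-th standard generator of `(ℤ/p)^n`, as an element of the group ring. -/
noncomputable def gen (i : Fin n) : ElemAbGroupRing p n k :=
  MonoidAlgebra.of k _ (Multiplicative.ofAdd (Pi.single i 1))

theorem gen_pow (i : Fin n) : gen p n k i ^ p = 1 := by
  rw [gen, ← map_pow, ← ofAdd_nsmul, ← Pi.single_smul, nsmul_one, CharP.cast_eq_zero,
    Pi.single_zero, ofAdd_zero, map_one]

theorem gen_sub_one_pow [Fact p.Prime] [CharP k p] (i : Fin n) : (gen p n k i - 1) ^ p = 0 := by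
  have : CharP (ElemAbGroupRing p n k) p :=
    charP_of_injective_algebraMap (algebraMap k (ElemAbGroupRing p n k)).injective p
  rw [sub_pow_char, gen_pow, one_pow, sub_self]

theorem exists_derivation_gen_sub_one [Fact p.Prime] [CharP k p] (i : Fin n) :
    ∃ δ : Derivation k (ElemAbGroupRing p n k) (ElemAbGroupRing p n k),
      ∀ j, δ (gen p n k j - 1) = (Pi.single i 1 : Fin n → ElemAbGroupRing p n k) j := by
  let χ (v : Multiplicative (Fin n → ZMod p)) : k := ZMod.castHom dvd_rfl k (v.toAdd i)
  let E : Derivation k (ElemAbGroupRing p n k) (ElemAbGroupRing p n k) :=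
    .mk' (weightMap χ) (weightMap_mul fun _ _ => map_add (ZMod.castHom dvd_rfl k) _ _)
  have hE (j : Fin n) : E (gen p n k j) =
      ZMod.castHom dvd_rfl k ((Pi.single j 1 : Fin n → ZMod p) i) • gen p n k j :=
    weightMap_of χ _
  refine ⟨gen p n k i ^ (p - 1) • E, fun j => ?_⟩
  rw [map_sub, Derivation.map_one_eq_zero, sub_zero, Derivation.smul_apply, hE]
  rcases eq_or_ne j i with rfl | hj
  · rw [Pi.single_eq_same, Pi.single_eq_same, map_one, one_smul, smul_eq_mul,
      pow_sub_one_mul (Fact.out : p.Prime).ne_zero, gen_pow]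
  · rw [Pi.single_eq_of_ne hj, Pi.single_eq_of_ne hj.symm, map_zero, zero_smul, smul_zero]

end ElemAbGroupRing

section RegularComplex

open CategoryTheory

variable (R : Type u) [Ring R]

/-- The regular module `R` as a chain complex concentrated in degree `0`. -/
noncomputable abbrev regularComplex : ChainComplex (ModuleCat.{u} R) ℤ :=
  (HomologicalComplex.single (ModuleCat.{u} R) (ComplexShape.down ℤ) 0).obj (ModuleCat.of R R)

theorem isPerfectComplex_regularComplex : IsPerfectComplex (regularComplex R) := by
  have hzero (i : ℤ) (hi : i ≠ 0) : Limits.IsZero ((regularComplex R).X i) :=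
    HomologicalComplex.isZero_single_obj_X _ _ _ _ hi
  refine ⟨⟨0, 0, fun i hi => hzero i (by omega)⟩, fun i => ?_⟩
  rcases eq_or_ne i 0 with rfl | hi
  · let e : R ≃ₗ[R] (regularComplex R).X 0 :=
      (HomologicalComplex.singleObjXSelf (ComplexShape.down ℤ) 0
        (ModuleCat.of R R)).symm.toLinearEquiv
    exact ⟨Module.Finite.equiv e, Module.Projective.of_equiv e⟩
  · have := ModuleCat.subsingleton_of_isZero (hzero i hi)
    exact ⟨inferInstance, inferInstance⟩

theorem not_acyclic_regularComplex [Nontrivial R] : ¬ (regularComplex R).Acyclic := fun h =>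
  have := ModuleCat.subsingleton_of_isZero <|
    (h 0).isZero_homology.of_iso (HomologicalComplex.singleObjHomologySelfIso _ 0 _).symm
  not_subsingleton R this

theorem chainHomologyDim_regularComplex (k : Type u) [Field k] [Algebra k R] :
    chainHomologyDim k (regularComplex R) = eDim k R := by
  let restrict := ModuleCat.restrictScalars (algebraMap k R)
  let e : restrict.obj ((regularComplex R).homology 0) ≃ₗ[k] restrict.obj (ModuleCat.of R R) :=
    (restrict.mapIso (HomologicalComplex.singleObjHomologySelfIso _ 0 _)).toLinearEquiv
  let eR : R ≃ₗ[k] restrict.obj (ModuleCat.of R R) :=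
    { AddEquiv.refl R with map_smul' := fun c r => Algebra.smul_def c r }
  rw [chainHomologyDim, tsum_eq_single 0 fun i hi => ?_]
  · exact congrArg Cardinal.toENat (e.trans eR.symm).rank_eq
  · have : Subsingleton (restrict.obj ((regularComplex R).homology i)) :=
      ModuleCat.subsingleton_of_isZero (restrict.map_isZero
        (HomologicalComplex.isZero_single_obj_homology _ _ _ _ hi))
    rw [eDim, rank_subsingleton', map_zero]

end RegularComplex

theorem ElemAbGroupRing.chainHomologyDim_mem {p n : ℕ} [Fact p.Prime] {k : Type u} [Field k]
    [CharP k p] {C : ChainComplex (ModuleCat.{u} (ElemAbGroupRing p n k)) ℤ}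
    (hC : IsPerfectComplex C) (hne : ¬ C.Acyclic) :
    chainHomologyDim k C ∈ fiberHomologyDims p n k := by
  choose δ hδ using exists_derivation_gen_sub_one p n k
  have : Module.Finite k (ElemAbGroupRing p n k) := .of_basis (MonoidAlgebra.basis _ k)
  exact chainHomologyDim_mem_fiberHomologyDims (gen_sub_one_pow p n k) hδ hC hne

theorem theorem4p7 (p : ℕ) [Fact p.Prime] (n : ℕ) (k : Type u) [Field k] [CharP k p] :
    ∃ b : ℕ, IsLeast (fiberHomologyDims p n k) (b : ℕ∞) ∧
      ∀ C : ChainComplex (ModuleCat.{u} (ElemAbGroupRing p n k)) ℤ,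
        IsPerfectComplex C → ¬ C.Acyclic → (b : ℕ∞) ≤ chainHomologyDim k C := by
  let R := ElemAbGroupRing p n k
  have : Module.Finite k R := .of_basis (MonoidAlgebra.basis _ k)
  have hR : eDim k R ∈ fiberHomologyDims p n k :=
    chainHomologyDim_regularComplex R k ▸
      ElemAbGroupRing.chainHomologyDim_mem (isPerfectComplex_regularComplex R)
        (not_acyclic_regularComplex R)
  have hfin : sInf (fiberHomologyDims p n k) ≠ ⊤ :=
    ne_top_of_le_ne_top (Cardinal.toENat_ne_top.2 (Module.rank_lt_aleph0 k R)) (sInf_le hR)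
  refine ⟨(sInf (fiberHomologyDims p n k)).toNat, ?_⟩
  rw [ENat.natCast_toNat hfin]
  exact ⟨⟨csInf_mem ⟨_, hR⟩, fun _ => sInf_le⟩,
    fun _ hC hne => sInf_le (ElemAbGroupRing.chainHomologyDim_mem hC hne)⟩
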